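/- Let $n\ge 1$ and let $\Phi=\{\pm e_i\}\cup\{\pm e_i\pm e_j: i\neq j\}$ be the root system of type $B_n$, with Weyl group $W$ (signed permutations of $e_1,\dots,e_n$), positive roots $e_i$ and $e_i\pm e_j$ ($i<j$), and Weyl vector $\rho=\tfrac12\sum_{j=1}^n(2n-2j+1)e_j$. For a dominant weight $\mu$ let $$\chi(\mu)=\frac{\sum_{w\in W}(-1)^{\ell(w)}e^{w(\mu+\rho)}}{\sum_{w\in W}(-1)^{\ell(w)}e^{w\rho}}$$ be the irreducible character of highest weight $\mu$. Let $$\Delta(q,t)=\prod_{i\ge0}\left(\frac{1-q^{i+1}}{1-tq^i}\right)^{n}\prod_{\alpha\in\Phi}\frac{1-q^{i+1}e^\alpha}{1-tq^ie^\alpha}$$ be the Macdonald kernel, regarded as a formal power series in $q,t$ whose coefficients lie in the complex group algebra spanned by the formal exponentials $e^\mu$. There is a unique family of power series $C_\mu(q,t)\in\mathbb C[[q,t]]$, indexed by the dominant weights $\mu$ of $\Phi$, such that for each $a,b\ge 0$ the coefficient of $q^at^b$ is nonzero in only finitely many $C_\mu$, and $$\Delta(q,t)=\sum_{\mu}C_\mu(q,t)\,\chi(\mu).$$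 For $1\le m\le n$ let $C_m=C_m(q)$ be the series obtained from $C_{e_1+\cdots+e_m}(q,t)$ by the specialization $q\to-q$, $t\to q^2$ (the weight $e_1+\cdots+e_m$ is the fundamental weight $\omega_m$ for $m<n$, and $2\omega_n$ for $m=n$). Set $h=n-m/2$ if $m$ is even and $h=(m-1)/2$ if $m$ is odd; then $h<n$, and $$C_m=\binom{n}{h}_{q^4}\ \prod_{j=1}^{h}\left(1+q^{4j-1}\right)\ \prod_{r=1}^{n-h-1}\left(1+q^{4r-1}\right)\ \left(q^{2(n-h)}+q^{2(n-h)-1}\right),$$ where $\binom{n}{h}_q=\frac{(n)_q!}{(h)_q!\,(n-h)_q!}$, $(k)_q!=\prod_{i=1}^k(i)_q$, $(i)_q=1+q+\cdots+q^{i-1}$, and $\binom{n}{h}_{q^4}$ is obtained by replacing $q$ by $q^4$. In particular $C_m$ is a polynomial in $q$. -/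

import Mathlib

open scoped Polynomial PowerSeries

noncomputable section

namespace TypeB

/-! ### The root system of type B, its Weyl group and its weights

Weights are vectors of `ℚ^n` in the standard orthonormal basis `e_1, …, e_n`
(indexed here by `Fin n`, so that `e_j` has index `j - 1` in the code). -/

/-- The ambient space of the weights. -/
abbrev Wt (n : ℕ) : Type := Fin n → ℚ

/-- The roots `± e_i` and `± e_i ± e_j` with `i ≠ j`. -/
def roots (n : ℕ) : Finset (Wt n) :=
  (Finset.univ.image fun p : Fin n × ℤˣ =>
      (Pi.single p.1 (((p.2 : ℤˣ) : ℤ) : ℚ) : Wt n)) ∪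
  ((Finset.univ.filter fun p : (Fin n × Fin n) × (ℤˣ × ℤˣ) => p.1.1 ≠ p.1.2).image fun p =>
      (Pi.single p.1.1 ((p.2.1 : ℤ) : ℚ) + Pi.single p.1.2 ((p.2.2 : ℤ) : ℚ) : Wt n))

/-- The Weyl vector `ρ = ½ ∑_j (2n - 2j + 1) e_j`, `1 ≤ j ≤ n`. -/
def rho (n : ℕ) : Wt n := fun i => (2 * (n : ℚ) - 2 * ((i : ℕ) + 1 : ℚ) + 1) / 2

/-- Dominant integral weights: all coordinates are integers or all are half-odd integers,
and they are weakly decreasing and nonnegative. -/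
def IsDominant {n : ℕ} (μ : Wt n) : Prop :=
  ((∀ i, ∃ k : ℤ, μ i = k) ∨ (∀ i, ∃ k : ℤ, μ i = k + 1 / 2)) ∧
    Antitone μ ∧ ∀ i, 0 ≤ μ i

/-- The set of dominant weights. -/
abbrev DominantWeight (n : ℕ) : Type := {μ : Wt n // IsDominant μ}

/-- The weight `e_1 + ⋯ + e_m`: the fundamental weight `ω_m` if `1 ≤ m < n`, and `2 ω_n`
if `m = n`. -/
def omegaWeight (n m : ℕ) : DominantWeight n :=
  ⟨fun i => if (i : ℕ) < m then 1 else 0, by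
    refine ⟨Or.inl fun i => ?_, fun i j hij => ?_, fun i => ?_⟩
    · by_cases h : (i : ℕ) < m
      · exact ⟨1, by simp [h]⟩
      · exact ⟨0, by simp [h]⟩
    · have hij' : (i : ℕ) ≤ j := hij
      by_cases hj : (j : ℕ) < m
      · have hi : (i : ℕ) < m := by omega
        simp [hi, hj]
      · simp only [hj, if_false]
        split_ifs <;> norm_num
    · show (0 : ℚ) ≤ if (i : ℕ) < m then 1 else 0
      split_ifs <;> norm_num⟩

/-- The Weyl group, realised as the group of signed permutations. -/
abbrev SignedPerm (n : ℕ) : Type := Equiv.Perm (Fin n) × (Fin n → ℤˣ)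

/-- The signed permutation `e_i ↦ ε_{σ i} e_{σ i}` acting on weights. -/
def act {n : ℕ} (w : SignedPerm n) (μ : Wt n) : Wt n :=
  fun i => ((w.2 i : ℤ) : ℚ) * μ (w.1.symm i)

/-- The sign `(-1)^{l(w)}`, i.e. the determinant of `w`. -/
def sgn {n : ℕ} (w : SignedPerm n) : ℤ :=
  ((Equiv.Perm.sign w.1 * ∏ i, w.2 i : ℤˣ) : ℤ)

/-! ### Characters -/

/-- The group algebra spanned by the formal exponentials `e^μ`. -/
abbrev GroupAlg (n : ℕ) : Type := AddMonoidAlgebra ℂ (Wt n)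

/-- The formal exponential `e^μ`. -/
def expo {n : ℕ} (μ : Wt n) : GroupAlg n := AddMonoidAlgebra.single μ 1

/-- The alternating sum `∑_w (-1)^{l(w)} e^{w μ}` over the Weyl group. -/
def alternant {n : ℕ} (μ : Wt n) : GroupAlg n :=
  ∑ w : SignedPerm n, (sgn w : ℂ) • expo (act w μ)

open Classical in
/-- The irreducible character `χ(μ)`, given by the Weyl character formula: the quotient of
the alternating sum of `μ + ρ` by that of `ρ`. -/
def chi {n : ℕ} (μ : DominantWeight n) : GroupAlg n :=
  if h : ∃ x : GroupAlg n, x * alternant (rho n) = alternant (μ.1 + rho n)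
  then h.choose else 0

/-! ### The Macdonald kernel

`Δ(q,t) = ∏_{i ≥ 0} ((1 - q^{i+1}) / (1 - t q^i))^n
            ∏_{α} (1 - q^{i+1} e^α) / (1 - t q^i e^α)`,
a formal power series in `q` (variable `0`) and `t` (variable `1`) over the group algebra. -/

/-- Formal power series in `q` and `t` with coefficients in `R`. -/
abbrev QT (R : Type) : Type := MvPowerSeries (Fin 2) R

/-- `(1 - q^{i+1} e^μ) / (1 - t q^i e^μ)`. -/
def factor {n : ℕ} (i : ℕ) (μ : Wt n) : QT (GroupAlg n) :=
  (1 - MvPowerSeries.X 0 ^ (i + 1) * MvPowerSeries.C (expo μ)) *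
    MvPowerSeries.invOfUnit
      (1 - MvPowerSeries.X 1 * MvPowerSeries.X 0 ^ i * MvPowerSeries.C (expo μ)) 1

/-- The `i`-th factor of the infinite product; it is congruent to `1` modulo `q^i`. -/
def layer (n i : ℕ) : QT (GroupAlg n) :=
  factor i 0 ^ n * ∏ α ∈ roots n, factor i α

/-- The Macdonald kernel. As `layer n i ≡ 1` modulo `q^i`, the coefficient of `q^a t^b` of the
infinite product is that of the product of the layers with `i ≤ a`
(see `coeff_prod_layer`). -/
def macdonaldKernel (n : ℕ) : QT (GroupAlg n) := fun d =>
  MvPowerSeries.coeff d (∏ i ∈ Finset.range (d 0 + 1), layer n i)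

lemma dvd_factor_sub_one {n : ℕ} (i : ℕ) (μ : Wt n) :
    (MvPowerSeries.X 0 ^ i : QT (GroupAlg n)) ∣ factor i μ - 1 := by
  have h := MvPowerSeries.mul_invOfUnit
    (1 - MvPowerSeries.X 1 * MvPowerSeries.X 0 ^ i * MvPowerSeries.C (expo μ) :
      QT (GroupAlg n)) 1 (by simp)
  unfold factor
  set v := MvPowerSeries.invOfUnit
    (1 - MvPowerSeries.X 1 * MvPowerSeries.X 0 ^ i * MvPowerSeries.C (expo μ) :
      QT (GroupAlg n)) 1
  refine ⟨(MvPowerSeries.X 1 - MvPowerSeries.X 0) * MvPowerSeries.C (expo μ) * v, ?_⟩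
  linear_combination h

lemma dvd_layer_sub_one (n i : ℕ) :
    (MvPowerSeries.X 0 ^ i : QT (GroupAlg n)) ∣ layer n i - 1 := by
  have key : ∀ μ : Wt n, Ideal.Quotient.mk
      (Ideal.span {(MvPowerSeries.X 0 ^ i : QT (GroupAlg n))}) (factor i μ) = 1 := fun μ => by
    rw [← map_one (Ideal.Quotient.mk _), Ideal.Quotient.eq, Ideal.mem_span_singleton]
    exact dvd_factor_sub_one i μ
  rw [← Ideal.mem_span_singleton, ← Ideal.Quotient.eq, layer, map_mul, map_pow, map_prod]
  simp [key]

/-- The defining coefficients of the kernel are those of every long enough partial product. -/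
lemma coeff_prod_layer (n : ℕ) (d : Fin 2 →₀ ℕ) (N : ℕ) (hN : d 0 + 1 ≤ N) :
    MvPowerSeries.coeff d (∏ i ∈ Finset.range N, layer n i) =
      MvPowerSeries.coeff d (macdonaldKernel n) := by
  induction N, hN using Nat.le_induction with
  | base => rfl
  | succ N hN ih =>
    obtain ⟨g, hg⟩ := dvd_layer_sub_one n N
    have h1 : layer n N = 1 + MvPowerSeries.X 0 ^ N * g := by rw [← hg]; ring
    rw [Finset.prod_range_succ, h1, mul_add, mul_one, map_add, ih]
    have h2 : MvPowerSeries.coeff d ((∏ i ∈ Finset.range N, layer n i) *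
        (MvPowerSeries.X 0 ^ N * g)) = 0 := by
      refine (MvPowerSeries.X_pow_dvd_iff (s := (0 : Fin 2)) (n := N)).1 ?_ d (by omega)
      exact ⟨(∏ i ∈ Finset.range N, layer n i) * g, by ring⟩
    rw [h2, add_zero]

/-- `Δ(q,t) = ∑_μ C_μ(q,t) χ(μ)`, the sum being over the dominant weights: for each monomial
`q^a t^b` only finitely many `C_μ` contribute, and the coefficients agree. -/
def IsKernelExpansion (n : ℕ) (C : DominantWeight n → QT ℂ) : Prop :=
  ∀ d : Fin 2 →₀ ℕ,
    (Function.support fun μ => MvPowerSeries.coeff d (C μ)).Finite ∧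
    MvPowerSeries.coeff d (macdonaldKernel n) =
      ∑ᶠ μ, MvPowerSeries.coeff d (C μ) • chi μ

/-- The specialization `q → -q`, `t → q^2`. -/
def specialize (f : QT ℂ) : ℂ⟦X⟧ :=
  MvPowerSeries.subst (![-PowerSeries.X, PowerSeries.X ^ 2] : Fin 2 → ℂ⟦X⟧) f

/-- The substitution is a legitimate one: both series have zero constant term. -/
lemma hasSubst_specialize :
    MvPowerSeries.HasSubst (![-PowerSeries.X, PowerSeries.X ^ 2] : Fin 2 → ℂ⟦X⟧) := by
  refine MvPowerSeries.hasSubst_of_constantCoeff_zero fun s => ?_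
  change PowerSeries.constantCoeff _ = 0
  fin_cases s <;> simp

/-! ### Gaussian binomials -/

/-- `(k)_q = 1 + q + ⋯ + q^{k-1}`. -/
def qInt (k : ℕ) : ℂ[X] := ∑ i ∈ Finset.range k, Polynomial.X ^ i

/-- `(k)_q! = ∏_{i=1}^k (i)_q`. -/
def qFactorial (k : ℕ) : ℂ[X] := ∏ i ∈ Finset.Icc 1 k, qInt i

/-- The `q`-binomial `(n)_q! / ((m)_q! (n-m)_q!)`; the division of polynomials is exact
(see `qBinomial_mul`). -/
def qBinomial (n m : ℕ) : ℂ[X] := qFactorial n / (qFactorial m * qFactorial (n - m))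

lemma qInt_add (a b : ℕ) : qInt (a + b) = qInt a + Polynomial.X ^ a * qInt b := by
  simp only [qInt, Finset.sum_range_add, pow_add, Finset.mul_sum]

lemma qFactorial_succ (k : ℕ) : qFactorial (k + 1) = qFactorial k * qInt (k + 1) := by
  rw [qFactorial, Finset.prod_Icc_succ_top (by omega), qFactorial]

lemma qFactorial_dvd : ∀ a b : ℕ, qFactorial a * qFactorial b ∣ qFactorial (a + b)
  | 0, b => by simp [qFactorial]
  | a + 1, 0 => by simp [qFactorial]
  | a + 1, b + 1 => by
    obtain ⟨u, hu⟩ := qFactorial_dvd a (b + 1)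
    obtain ⟨v, hv⟩ := qFactorial_dvd (a + 1) b
    have e : a + 1 + (b + 1) = (a + (b + 1)) + 1 := by omega
    have e' : a + 1 + b = a + (b + 1) := by omega
    rw [e'] at hv
    have hq : qInt (a + (b + 1) + 1) = qInt (a + 1) + Polynomial.X ^ (a + 1) * qInt (b + 1) := by
      rw [← qInt_add]; congr 1; omega
    refine ⟨u + Polynomial.X ^ (a + 1) * v, ?_⟩
    rw [e, qFactorial_succ, hq, mul_add, hu]
    nth_rewrite 2 [← hu]
    rw [hv, qFactorial_succ a, qFactorial_succ b]
    ring

lemma qBinomial_mul (n m : ℕ) (h : m ≤ n) :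
    qBinomial n m * (qFactorial m * qFactorial (n - m)) = qFactorial n := by
  have hd := qFactorial_dvd m (n - m)
  rw [Nat.add_sub_cancel' h] at hd
  rw [mul_comm]
  exact EuclideanDomain.mul_div_cancel' (by
    have hk : ∀ k, qFactorial k ≠ 0 := fun k => by
      refine Finset.prod_ne_zero_iff.2 fun i hi h0 => ?_
      have h1 := congrArg (Polynomial.eval 1) h0
      simp [qInt, Polynomial.eval_finsetSum] at h1
      simp at hi
      omega
    exact mul_ne_zero (hk _) (hk _)) hd

end TypeB

end

noncomputable section

namespace TypeB

/-! ### Gaussian binomials: the two Pascal rules -/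

/-! Write a_ρ for `alternant (rho n)` and x_i for e^{e_i}. Under q → -q, t → q² the i-th factor of
the kernel at α becomes (1 - (-q)^{i+1} e^α) / (1 - (-q)^{i+2} e^α), so the product telescopes to
(1+q)^n ∏_α (1 + q e^α), the graded character of the exterior algebra of so(2n+1)
(`prod_spec_factor`, `coeff_spec_kernel`). As so(2n+1) = Λ²V for the vector representation V, with
weights x_i, x_i⁻¹, 1 denoted y_0, …, y_{2n}, this character is ∏_{i<j} (1 + q y_i y_j)
(`adjointProd_eq`). Since e_1 + ⋯ + e_m is the highest weight of Λ^m V, C_m is the graded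
multiplicity of Λ^m V in Λ(Λ²V).

All m are treated at once with a variable z. By the dual Cauchy identity `alternant_rho_mul_prod`,
the multiplicities are generated, up to (-1)^n |W|, by the constant term of ∏ (1 + z y_i) ∏_{i<j} (1
+ q y_i y_j) a_ρ². Up to sign, a_ρ² ∏ (x_i - x_i⁻¹) is ∏_{i<j} (y_i - y_j) (`prod_vec_sub`), and
∏_{i<j} (y_i - y_j)(1 + q y_i y_j) is a Vandermonde product in the quantities y⁻¹ - q y, because ∏
y_i = 1. What is wanted is therefore the constant term of det / ∏ (x_i - x_i⁻¹), where det has the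
rows (1 + z y)(y^{-j} + (-q)^j y^j) for 0 < j ≤ 2n and 1 + z y for j = 0 (`det_twoTerm`).

For rows y^{l_j} with l weakly decreasing, this functional sees only the parities of the l_j, and
vanishes when two neighbouring parities agree. So for D strictly decreasing, the rows (1 + z y)
y^{D_j} give a constant times z^r + z^{2n+1-r}, with r the number of j for which D_j + j is odd
(`oddDet_strictAnti`). Reordering the expanded rows into decreasing lists leaves a weighted count of
lists by r (`coeff_adjointProd`). The number r is always even, so exactly one of r = m and r =
2n+1-m contributes, and the count obeys a recursion solved by the two q-Pascal rules in q⁴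
(`rowSum_two_mul`).

Existence and uniqueness of the C_μ hold because an antisymmetric element with half-odd exponents is
determined by its coefficients at the weights μ + ρ (`IsAntisymm.eq_zero`). -/

lemma qInt_ne_zero (k : ℕ) (hk : k ≠ 0) : qInt k ≠ 0 := fun h0 => by
  have h1 := congrArg (Polynomial.eval 1) h0
  simp [qInt, Polynomial.eval_finsetSum] at h1
  exact hk h1

lemma qFactorial_ne_zero (k : ℕ) : qFactorial k ≠ 0 :=
  Finset.prod_ne_zero_iff.2 fun i hi => qInt_ne_zero i (by simp at hi; omega)

/-- Clearing the nonzero denominator turns identities between Gaussian binomials, defined by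
polynomial division, into identities between q-factorials. -/
lemma qBinomial_eq_of_mul {n m : ℕ} (h : m ≤ n) {p : ℂ[X]}
    (hp : p * (qFactorial m * qFactorial (n - m)) = qFactorial n) : qBinomial n m = p :=
  mul_right_cancel₀ (mul_ne_zero (qFactorial_ne_zero m) (qFactorial_ne_zero (n - m)))
    ((qBinomial_mul n m h).trans hp.symm)

lemma qBinomial_self (n : ℕ) : qBinomial n n = 1 :=
  qBinomial_eq_of_mul le_rfl (by simp [qFactorial])

lemma qBinomial_symm {n m : ℕ} (h : m ≤ n) : qBinomial n (n - m) = qBinomial n m :=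
  qBinomial_eq_of_mul (Nat.sub_le n m) (by
    rw [Nat.sub_sub_self h, mul_comm (qFactorial (n - m)), qBinomial_mul n m h])

/-- Comes from splitting the top factor as (a+b+2)_q = (a+1)_q + q^{a+1} (b+1)_q. -/
lemma qBinomial_pascal (a b : ℕ) :
    qBinomial (a + 1 + (b + 1)) (a + 1) =
      qBinomial (a + (b + 1)) a + Polynomial.X ^ (a + 1) * qBinomial (a + 1 + b) (a + 1) := by
  refine qBinomial_eq_of_mul (by omega) ?_
  have h1 := qBinomial_mul (a + (b + 1)) a (by omega)
  have h2 := qBinomial_mul (a + 1 + b) (a + 1) (by omega)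
  rw [show a + (b + 1) - a = b + 1 by omega] at h1
  rw [show a + 1 + b - (a + 1) = b by omega] at h2
  rw [show a + 1 + (b + 1) - (a + 1) = b + 1 by omega,
    show a + 1 + (b + 1) = (a + (b + 1)) + 1 by omega, qFactorial_succ (a + (b + 1)),
    show a + (b + 1) + 1 = (a + 1) + (b + 1) by omega, qInt_add]
  rw [show a + 1 + b = a + (b + 1) by omega] at h2 ⊢
  rw [mul_add, ← h1]
  nth_rewrite 2 [h1]
  rw [← h2, qFactorial_succ a, qFactorial_succ b]
  ring

lemma qBinomial_pascal' (a b : ℕ) :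
    qBinomial (a + 1 + (b + 1)) (a + 1) =
      Polynomial.X ^ (b + 1) * qBinomial (a + (b + 1)) a + qBinomial (a + 1 + b) (a + 1) := by
  have h := qBinomial_pascal b a
  rw [show b + 1 + (a + 1) = a + 1 + (b + 1) by omega, show b + (a + 1) = a + 1 + b by omega,
    show b + 1 + a = a + (b + 1) by omega] at h
  have e1 := qBinomial_symm (n := a + 1 + (b + 1)) (m := a + 1) (by omega)
  have e2 := qBinomial_symm (n := a + 1 + b) (m := a + 1) (by omega)
  have e3 := qBinomial_symm (n := a + (b + 1)) (m := a) (by omega)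
  rw [show a + 1 + (b + 1) - (a + 1) = b + 1 by omega] at e1
  rw [show a + 1 + b - (a + 1) = b by omega] at e2
  rw [show a + (b + 1) - a = b + 1 by omega] at e3
  rw [← e1, h, e2, e3, add_comm]

/-! ### Signed lists and their number of odd rows -/

/-- The weighted lists of exponents in the expansion of the wedge product of the vectors
`v (-j) + (-q)^j v j`, each of them strictly decreasing. -/
def signedLists (q : ℂ) : ℕ → List (ℂ × List ℤ)
  | 0 => [(1, [0])]
  | a + 1 =>
    (signedLists q a).map (fun p => (p.1, p.2 ++ [-((a : ℤ) + 1)])) ++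
      (signedLists q a).map (fun p => (p.1 * q ^ (a + 1), ((a : ℤ) + 1) :: p.2))

/-- The number of positions `j` of a list `D` for which `D_j + j` is odd. -/
def oddRows : List ℤ → ℕ
  | [] => 0
  | d :: D => (if Odd d then 1 else 0) + (D.length - oddRows D)

lemma oddRows_le_length : ∀ D : List ℤ, oddRows D ≤ D.length
  | [] => le_rfl
  | d :: D => by
    have := oddRows_le_length D
    rw [oddRows, List.length_cons]
    split_ifs <;> omega

lemma oddRows_concat (d : ℤ) : ∀ D : List ℤ,
    oddRows (D ++ [d]) = oddRows D + if Odd (d + D.length) then 1 else 0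
  | [] => by simp [oddRows]
  | c :: D => by
    have := oddRows_le_length D
    rw [List.cons_append, oddRows, oddRows_concat d D, oddRows]
    simp only [List.length_append, List.length_cons, List.length_nil]
    have h : Odd (d + ((D.length + 1 : ℕ) : ℤ)) ↔ ¬ Odd (d + (D.length : ℤ)) := by
      rw [Int.not_odd_iff_even, Int.odd_iff, Int.even_iff]
      omega
    simp only [h]
    split_ifs <;> omega

lemma length_of_mem_signedLists (q : ℂ) : ∀ (a : ℕ), ∀ p ∈ signedLists q a, p.2.length = a + 1
  | 0, p, hp => by simp [signedLists] at hp; simp [hp]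
  | a + 1, p, hp => by
    simp only [signedLists, List.mem_append, List.mem_map] at hp
    rcases hp with ⟨p', hp', rfl⟩ | ⟨p', hp', rfl⟩ <;>
    simp [length_of_mem_signedLists q a p' hp']

lemma signedLists_bounds (q : ℂ) : ∀ (a : ℕ), ∀ p ∈ signedLists q a,
    p.2.Pairwise (· > ·) ∧ ∀ d ∈ p.2, -(a : ℤ) ≤ d ∧ d ≤ a
  | 0, p, hp => by simp [signedLists] at hp; simp [hp]
  | a + 1, p, hp => by
    simp only [signedLists, List.mem_append, List.mem_map] at hp
    rcases hp with ⟨p', hp', rfl⟩ | ⟨p', hp', rfl⟩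
    · obtain ⟨h1, h2⟩ := signedLists_bounds q a p' hp'
      refine ⟨List.pairwise_append.2 ⟨h1, by simp, fun x hx y hy => ?_⟩, fun d hd => ?_⟩
      · have := h2 x hx
        simp at hy
        omega
      · simp only [List.mem_append, List.mem_singleton] at hd
        rcases hd with hd | rfl
        · have := h2 d hd
          push_cast; omega
        · push_cast; omega
    · obtain ⟨h1, h2⟩ := signedLists_bounds q a p' hp'
      refine ⟨List.pairwise_cons.2 ⟨fun x hx => ?_, h1⟩, fun d hd => ?_⟩
      · have := h2 x hx
        omega
      · simp only [List.mem_cons] at hd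
        rcases hd with rfl | hd
        · push_cast; omega
        · have := h2 d hd
          push_cast; omega

/-- The total weight of the signed lists with exactly `k` odd rows. -/
def rowSum (q : ℂ) (a k : ℕ) : ℂ :=
  ((signedLists q a).map fun p => if oddRows p.2 = k then p.1 else 0).sum

lemma rowSum_zero (q : ℂ) (k : ℕ) : rowSum q 0 k = if k = 0 then 1 else 0 := by
  simp [rowSum, signedLists, oddRows, eq_comm]

/-- A new last entry -(a+1) stands in position a+1, so the sum of the two is 0 and the count is
unchanged. A new first entry a+1 shifts the a+1 old positions by one, which exchanges odd and even
rows; together with its own contribution, the count r becomes 2⌊(a+2)/2⌋ - r. -/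
lemma rowSum_succ (q : ℂ) (a k : ℕ) :
    rowSum q (a + 1) k = rowSum q a k +
      if k ≤ 2 * ((a + 2) / 2) then q ^ (a + 1) * rowSum q a (2 * ((a + 2) / 2) - k) else 0 := by
  rw [rowSum, signedLists, List.map_append, List.sum_append, List.map_map, List.map_map]
  have hcons : ∀ p ∈ signedLists q a, oddRows (((a : ℤ) + 1) :: p.2) =
      2 * ((a + 2) / 2) - oddRows p.2 ∧ oddRows p.2 ≤ 2 * ((a + 2) / 2) := fun p hp => by
    have h1 := length_of_mem_signedLists q a p hp
    have h2 := oddRows_le_length p.2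
    rw [oddRows, h1]
    have h3 : Odd ((a : ℤ) + 1) ↔ a % 2 = 0 := by
      rw [Int.odd_iff]; omega
    by_cases h4 : a % 2 = 0
    · rw [if_pos (h3.2 h4)]; omega
    · rw [if_neg (fun h => h4 (h3.1 h))]; omega
  congr 1
  · rw [rowSum]
    refine congrArg List.sum (List.map_congr_left fun p hp => ?_)
    have h1 := length_of_mem_signedLists q a p hp
    simp [oddRows_concat, h1]
  · split_ifs with hk
    · rw [rowSum, ← List.sum_map_mul_left]
      refine congrArg List.sum (List.map_congr_left fun p hp => ?_)
      obtain ⟨h1, h2⟩ := hcons p hp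
      simp only [Function.comp_apply, h1]
      split_ifs <;> first | omega | ring
    · refine List.sum_eq_zero fun x hx => ?_
      simp only [List.mem_map, Function.comp_apply] at hx
      obtain ⟨p, hp, rfl⟩ := hx
      obtain ⟨h1, h2⟩ := hcons p hp
      rw [if_neg (by omega)]

/-- Both moves of the recursion preserve the parity of the count, which starts at 0. -/
lemma rowSum_odd (q : ℂ) : ∀ a k : ℕ, Odd k → rowSum q a k = 0
  | 0, k, hk => by
    rw [rowSum_zero, if_neg]
    rintro rfl
    simp at hk
  | a + 1, k, hk => by
    rw [rowSum_succ, rowSum_odd q a k hk, zero_add]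
    split_ifs with h
    · rw [rowSum_odd q a, mul_zero]
      rw [Nat.odd_iff] at hk ⊢
      omega
    · rfl

lemma rowSum_eq_zero_of_lt (q : ℂ) (a k : ℕ) (hk : a + 1 < k) : rowSum q a k = 0 := by
  refine List.sum_eq_zero fun x hx => ?_
  simp only [List.mem_map] at hx
  obtain ⟨p, hp, rfl⟩ := hx
  have h1 := length_of_mem_signedLists q a p hp
  have h2 := oddRows_le_length p.2
  rw [if_neg (by omega)]

/-- Over two steps the reflection k ↦ n+1-k is the same both times: used twice it restores k with
weight q^{2n+1} q^{2n+2}, used once it leaves q^{2n+1} + q^{2n+2}. -/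
lemma rowSum_add_two (q : ℂ) (n k : ℕ) (hk : k ≤ n + 1) :
    rowSum q (2 * (n + 1)) (2 * k) = (1 + q ^ (4 * n + 3)) * rowSum q (2 * n) (2 * k) +
      q ^ (2 * n + 1) * (1 + q) * rowSum q (2 * n) (2 * (n + 1 - k)) := by
  rw [show 2 * (n + 1) = 2 * n + 1 + 1 by ring, rowSum_succ, rowSum_succ, rowSum_succ,
    show 2 * ((2 * n + 1 + 2) / 2) = 2 * (n + 1) by omega,
    show 2 * ((2 * n + 2) / 2) = 2 * (n + 1) by omega, if_pos (by omega), if_pos (by omega),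
    if_pos (by omega), show 2 * (n + 1) - (2 * (n + 1) - 2 * k) = 2 * k by omega,
    show 2 * (n + 1) - 2 * k = 2 * (n + 1 - k) by omega]
  ring

/-- `∏_{j=1}^k (1 + q^{4j-1})`. -/
def quadProd (q : ℂ) (k : ℕ) : ℂ := ∏ j ∈ Finset.Icc 1 k, (1 + q ^ (4 * j - 1))

lemma quadProd_succ (q : ℂ) (k : ℕ) :
    quadProd q (k + 1) = quadProd q k * (1 + q ^ (4 * k + 3)) := by
  rw [quadProd, Finset.prod_Icc_succ_top (by omega), quadProd,
    show 4 * (k + 1) - 1 = 4 * k + 3 by omega]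

lemma rowSum_two_mul_zero (q : ℂ) : ∀ n : ℕ, rowSum q (2 * n) 0 = quadProd q n
  | 0 => by simp [rowSum_zero, quadProd]
  | n + 1 => by
    have h := rowSum_add_two q n 0 (by omega)
    rw [mul_zero, rowSum_two_mul_zero q n,
      rowSum_eq_zero_of_lt q (2 * n) (2 * (n + 1 - 0)) (by omega)] at h
    rw [h, quadProd_succ]
    ring

/-- The total weight of the signed lists of length `2n + 1` with `2k > 0` odd rows. -/
lemma rowSum_two_mul (q : ℂ) : ∀ k l : ℕ, rowSum q (2 * (k + 1 + l)) (2 * (k + 1)) =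
    (qBinomial (k + 1 + l) l).eval (q ^ 4) * quadProd q l * quadProd q k *
      (q ^ (2 * k + 2) + q ^ (2 * k + 1)) := by
  -- The recurrence exchanges the roles of k and l, so the induction is on k + l with both free; the
  -- lower index k + 1 is the one in the Pascal rules.
  suffices H : ∀ n k l : ℕ, k + l = n → rowSum q (2 * (k + 1 + l)) (2 * (k + 1)) =
      (qBinomial (k + 1 + l) (k + 1)).eval (q ^ 4) * quadProd q l * quadProd q k *
        (q ^ (2 * k + 2) + q ^ (2 * k + 1)) by
    intro k l
    have h := qBinomial_symm (n := k + 1 + l) (m := k + 1) (by omega)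
    rw [show k + 1 + l - (k + 1) = l by omega] at h
    rw [H _ k l rfl, h]
  intro n
  induction n with
  | zero =>
    intro k l hkl
    obtain rfl : k = 0 := by omega
    obtain rfl : l = 0 := by omega
    have h := rowSum_add_two q 0 1 (by omega)
    simp only [mul_zero, rowSum_zero] at h
    simp [h, qBinomial_self, quadProd]
    ring
  | succ n ih =>
    intro k l hkl
    rcases l with _ | l
    · obtain rfl : k = n + 1 := by omega
      have h := rowSum_add_two q (n + 1) (n + 1 + 1) (by omega)
      rw [show n + 1 + 1 + 0 = n + 1 + 1 by omega, h, rowSum_eq_zero_of_lt q _ _ (by omega),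
        Nat.sub_self, mul_zero, rowSum_two_mul_zero, qBinomial_self, Polynomial.eval_one]
      simp [quadProd]
      ring
    · have h := rowSum_add_two q (k + 1 + l) (k + 1) (by omega)
      rw [show k + 1 + (l + 1) = k + 1 + l + 1 by omega, h, ih k l (by omega),
        show k + 1 + l + 1 - (k + 1) = l + 1 by omega,
        show k + 1 + l = l + 1 + k by omega]
      have h2 := ih l k (by omega)
      have e1 := qBinomial_pascal k l
      have e2 := qBinomial_pascal' k l
      have e3 := qBinomial_symm (n := l + 1 + k) (m := l + 1) (by omega)
      rw [show l + 1 + k - (l + 1) = k by omega] at e3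
      rw [h2, ← e3]
      rw [show k + 1 + (l + 1) = l + 1 + k + 1 by omega, show k + (l + 1) = l + 1 + k by omega,
        show k + 1 + l = l + 1 + k by omega] at e1 e2
      have e1' := congrArg (Polynomial.eval (q ^ 4)) e1
      have e2' := congrArg (Polynomial.eval (q ^ 4)) e2
      simp only [Polynomial.eval_add, Polynomial.eval_mul, Polynomial.eval_pow,
        Polynomial.eval_X] at e1' e2'
      rw [quadProd_succ]
      generalize (qBinomial (l + 1 + k) k).eval (q ^ 4) = B2 at *
      generalize (qBinomial (l + 1 + k) (k + 1)).eval (q ^ 4) = B1 at *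
      generalize (qBinomial (l + 1 + k + 1) (k + 1)).eval (q ^ 4) = B0 at *
      -- In the new factor 1 + q^{4l+3}, the summand 1 multiplies the binomial expanded by the
      -- second Pascal rule and q^{4l+3} the one expanded by the first.
      linear_combination (-(quadProd q l * quadProd q k * (q ^ (2 * k + 2) + q ^ (2 * k + 1)))) * e2' -
        q ^ (4 * l + 3) * (quadProd q l * quadProd q k * (q ^ (2 * k + 2) + q ^ (2 * k + 1))) * e1'

/-! ### Wedge products of two-term vectors -/

lemma ExteriorAlgebra.prod_map_ι_mul_ι {M : Type*} [AddCommGroup M] [Module ℂ M]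
    (v : ℤ → M) (u : M) : ∀ D : List ℤ,
    (D.map fun d => ExteriorAlgebra.ι ℂ (v d)).prod * ExteriorAlgebra.ι ℂ u =
      (-1 : ℂ) ^ D.length • (ExteriorAlgebra.ι ℂ u *
        (D.map fun d => ExteriorAlgebra.ι ℂ (v d)).prod)
  | [] => by simp
  | d :: D => by
    have h := eq_neg_of_add_eq_zero_left (ExteriorAlgebra.ι_add_mul_swap (R := ℂ) (v d) u)
    rw [List.map_cons, List.prod_cons, mul_assoc, ExteriorAlgebra.prod_map_ι_mul_ι v u D,
      mul_smul_comm, ← mul_assoc, h, List.length_cons, pow_succ, ← mul_assoc]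
    simp

/-- The two-term vector `v (-j) + (-q)^j v j`, or `v 0` if `j = 0`. -/
def twoTerm {M : Type*} [AddCommGroup M] [Module ℂ M] (q : ℂ) (v : ℤ → M) (j : ℕ) : M :=
  if j = 0 then v 0 else v (-j) + (-q) ^ j • v j

/-- Moving v (a+1) to the front, past a+1 vectors, costs (-1)^{a+1}. This cancels the sign of
(-q)^{a+1}, so the lists carry positive powers of q. -/
lemma prod_ι_twoTerm {M : Type*} [AddCommGroup M] [Module ℂ M] (q : ℂ) (v : ℤ → M) : ∀ a : ℕ,
    (List.ofFn fun j : Fin (a + 1) => ExteriorAlgebra.ι ℂ (twoTerm q v j)).prod =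
      ((signedLists q a).map fun p =>
        p.1 • (p.2.map fun d => ExteriorAlgebra.ι ℂ (v d)).prod).sum
  | 0 => by simp [signedLists, twoTerm]
  | a + 1 => by
    rw [List.ofFn_succ', List.concat_eq_append, List.prod_append]
    simp only [Fin.val_castSucc, Fin.val_last, List.prod_cons, List.prod_nil, mul_one]
    rw [prod_ι_twoTerm q v a, signedLists, List.map_append, List.sum_append, List.map_map,
      List.map_map, ← List.sum_map_mul_right, ← List.sum_map_add]
    refine congrArg List.sum (List.map_congr_left fun p hp => ?_)
    have h1 := length_of_mem_signedLists q a p hp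
    rw [twoTerm, if_neg (by omega), map_add, map_smul, mul_add]
    congr 1
    · simp
    · rw [mul_smul_comm, smul_mul_assoc, ExteriorAlgebra.prod_map_ι_mul_ι, h1, smul_smul, smul_smul]
      simp only [Function.comp_apply, List.map_cons, List.prod_cons]
      push_cast
      rw [mul_comm _ p.1, mul_assoc, ← mul_pow, neg_mul_neg, mul_one]

/-- An alternating map evaluated at two-term vectors is the sum over the signed lists. -/
lemma alternatingMap_twoTerm {M : Type*} [AddCommGroup M] [Module ℂ M] (q : ℂ) (v : ℤ → M)
    (a : ℕ) (f : M [⋀^Fin (a + 1)]→ₗ[ℂ] ℂ) :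
    f (fun j => twoTerm q v j) =
      ((signedLists q a).map fun p => p.1 * f fun j => v (p.2.getD j 0)).sum := by
  -- The alternating map is extended to the exterior algebra by zero in the other degrees.
  set F : ExteriorAlgebra ℂ M →ₗ[ℂ] ℂ :=
    ExteriorAlgebra.liftAlternating (Function.update (fun i => 0) (a + 1) f) with hF
  have key : ∀ w : Fin (a + 1) → M,
      F (List.ofFn fun j => ExteriorAlgebra.ι ℂ (w j)).prod = f w := fun w => by
    rw [← ExteriorAlgebra.ιMulti_apply, hF, ExteriorAlgebra.liftAlternating_apply_ιMulti,
      Function.update_self]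
  rw [← key, prod_ι_twoTerm, map_list_sum, List.map_map]
  refine congrArg List.sum (List.map_congr_left fun p hp => ?_)
  have h1 := length_of_mem_signedLists q a p hp
  rw [Function.comp_apply, map_smul, smul_eq_mul, ← key]
  congr 3
  refine List.ext_getElem (by simp [h1]) fun i hi hi' => ?_
  have hi2 : i < p.2.length := by simpa using hi
  rw [List.getElem_map, List.getElem_ofFn, List.getD_eq_getElem _ _ hi2]

/-! ### The group algebra and the action of the Weyl group -/

variable {n : ℕ}

lemma expo_add (μ ν : Wt n) : expo (μ + ν) = expo μ * expo ν := by
  simp [expo, AddMonoidAlgebra.single_mul_single]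

lemma expo_zero : expo (0 : Wt n) = 1 := rfl

lemma expo_sum {ι : Type*} (s : Finset ι) (μ : ι → Wt n) :
    expo (∑ i ∈ s, μ i) = ∏ i ∈ s, expo (μ i) := by
  classical
  induction s using Finset.induction_on with
  | empty => simp [expo_zero]
  | insert a s ha ih => rw [Finset.sum_insert ha, Finset.prod_insert ha, expo_add, ih]

lemma coeff_expo (μ ν : Wt n) [Decidable (μ = ν)] :
    (expo μ).coeff ν = if μ = ν then 1 else 0 := by
  rw [expo, AddMonoidAlgebra.coeff_single, Finsupp.single_apply]

lemma linearMap_ext_expo {M : Type*} [AddCommMonoid M] [Module ℂ M] {F G : GroupAlg n →ₗ[ℂ] M}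
    (h : ∀ μ, F (expo μ) = G (expo μ)) : F = G := by
  refine LinearMap.ext fun f => ?_
  rw [← AddMonoidAlgebra.sum_coeff_single f, Finsupp.sum, map_sum, map_sum]
  refine Finset.sum_congr rfl fun μ _ => ?_
  have : AddMonoidAlgebra.single μ (f.coeff μ) = f.coeff μ • expo μ := by
    rw [expo, AddMonoidAlgebra.smul_single', mul_one]
  rw [this, map_smul, map_smul, h]

/-- The coefficient of `e^κ` as a linear functional. -/
def coeffAt (κ : Wt n) : GroupAlg n →ₗ[ℂ] ℂ where
  toFun f := f.coeff κ
  map_add' _ _ := rfl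
  map_smul' _ _ := rfl

lemma coeffAt_apply (κ : Wt n) (f : GroupAlg n) : coeffAt κ f = f.coeff κ := rfl

/-- The additive map `act w`. -/
def actAdd (w : SignedPerm n) : Wt n →+ Wt n where
  toFun := act w
  map_zero' := by ext i; simp [act]
  map_add' μ ν := by ext i; simp [act, mul_add]

lemma act_add (w : SignedPerm n) (μ ν : Wt n) : act w (μ + ν) = act w μ + act w ν :=
  (actAdd w).map_add μ ν

lemma sign_mul_self (ε : ℤˣ) : ((ε : ℤ) : ℚ) * ((ε : ℤ) : ℚ) = 1 := by
  rcases Int.units_eq_one_or ε with rfl | rfl <;> simp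

lemma act_injective (w : SignedPerm n) : Function.Injective (act w) := fun μ ν h => by
  ext i
  have h1 := congrFun h (w.1 i)
  simp only [act, Equiv.symm_apply_apply] at h1
  have h2 := congrArg (fun x => ((w.2 (w.1 i) : ℤ) : ℚ) * x) h1
  simpa only [← mul_assoc, sign_mul_self, one_mul] using h2

/-- The automorphism of the group algebra induced by a signed permutation. -/
def actHom (w : SignedPerm n) : GroupAlg n →ₐ[ℂ] GroupAlg n :=
  AddMonoidAlgebra.mapDomainAlgHom ℂ ℂ (actAdd w)

lemma actHom_expo (w : SignedPerm n) (μ : Wt n) : actHom w (expo μ) = expo (act w μ) := by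
  simp [actHom, expo, actAdd]

lemma coeff_actHom (w : SignedPerm n) (f : GroupAlg n) (κ : Wt n) :
    (actHom w f).coeff (act w κ) = f.coeff κ := by
  classical
  have h : coeffAt (act w κ) ∘ₗ (actHom w).toLinearMap = coeffAt κ := linearMap_ext_expo fun μ => by
    simp [coeffAt_apply, actHom_expo, coeff_expo, (act_injective w).eq_iff]
  exact LinearMap.congr_fun h f

/-- The composition of signed permutations. -/
def compW (w v : SignedPerm n) : SignedPerm n :=
  (w.1 * v.1, fun i => w.2 i * v.2 (w.1.symm i))

lemma act_compW (w v : SignedPerm n) (μ : Wt n) : act (compW w v) μ = act w (act v μ) := by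
  ext i
  simp [act, compW, mul_assoc, Equiv.Perm.mul_def]

lemma sgn_compW (w v : SignedPerm n) : sgn (compW w v) = sgn w * sgn v := by
  have h : ∏ i, v.2 (w.1.symm i) = ∏ i, v.2 i := Equiv.prod_comp w.1.symm v.2
  simp only [sgn, compW, Equiv.Perm.sign_mul, Finset.prod_mul_distrib, h]
  push_cast
  ring

lemma compW_bijective (w : SignedPerm n) : Function.Bijective (compW w) := by
  rw [← Finite.injective_iff_bijective]
  intro u v h
  simp only [compW, Prod.mk.injEq, mul_right_inj] at h
  refine Prod.ext h.1 (funext fun i => ?_)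
  have := congrFun h.2 (w.1 i)
  simpa using this

lemma sgn_mul_self (w : SignedPerm n) : (sgn w : ℂ) * sgn w = 1 := by
  rw [sgn]
  rcases Int.units_eq_one_or (Equiv.Perm.sign w.1 * ∏ i, w.2 i) with h | h <;> simp [h]

/-- Antisymmetric elements of the group algebra. -/
def IsAntisymm (g : GroupAlg n) : Prop := ∀ w, actHom w g = (sgn w : ℂ) • g

lemma isAntisymm_alternant (ν : Wt n) : IsAntisymm (alternant ν) := fun w => by
  simp only [alternant, map_sum, map_smul, actHom_expo, Finset.smul_sum]
  rw [← (compW_bijective w).sum_comp (fun u : SignedPerm n => (sgn w : ℂ) • (sgn u : ℂ) •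
    expo (act u ν))]
  refine Finset.sum_congr rfl fun u _ => ?_
  rw [sgn_compW, act_compW, smul_smul]
  push_cast
  rw [← mul_assoc, sgn_mul_self, one_mul]

lemma IsAntisymm.invariant_mul {f g : GroupAlg n} (hf : ∀ w, actHom w f = f) (hg : IsAntisymm g) :
    IsAntisymm (f * g) := fun w => by
  rw [map_mul, hf, hg, mul_smul_comm]

lemma IsAntisymm.coeff_act {g : GroupAlg n} (hg : IsAntisymm g) (w : SignedPerm n) (κ : Wt n) :
    g.coeff (act w κ) = sgn w * g.coeff κ := by
  have h := coeff_actHom w g κ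
  rw [hg w, AddMonoidAlgebra.coeff_smul_apply, smul_eq_mul] at h
  rw [← h, ← mul_assoc, sgn_mul_self, one_mul]

lemma IsAntisymm.sub {f g : GroupAlg n} (hf : IsAntisymm f) (hg : IsAntisymm g) :
    IsAntisymm (f - g) := fun w => by
  rw [map_sub, hf, hg, smul_sub]

lemma IsAntisymm.sum_smul {ι : Type*} (s : Finset ι) (c : ι → ℂ) (g : ι → GroupAlg n)
    (hg : ∀ i, IsAntisymm (g i)) : IsAntisymm (∑ i ∈ s, c i • g i) := fun w => by
  simp only [map_sum, map_smul, Finset.smul_sum]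
  exact Finset.sum_congr rfl fun i _ => by rw [hg i, smul_comm]

/-- The pairing of an antisymmetric element with an alternant. -/
lemma IsAntisymm.coeff_mul_alternant {g : GroupAlg n} (hg : IsAntisymm g) (ν : Wt n) :
    (g * alternant ν).coeff 0 = (-1) ^ n * Fintype.card (SignedPerm n) * g.coeff ν := by
  have h1 : (g * alternant ν).coeff 0 =
      ∑ w : SignedPerm n, (sgn w : ℂ) * g.coeff (-(act w ν)) := by
    rw [← coeffAt_apply, alternant, Finset.mul_sum, map_sum]
    refine Finset.sum_congr rfl fun w _ => ?_
    rw [mul_smul_comm, map_smul, coeffAt_apply, expo, AddMonoidAlgebra.coeff_mul_single_apply,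
      smul_eq_mul, mul_one, zero_add]
  -- As -1 lies in the Weyl group with determinant (-1)^n, antisymmetry makes all terms of the sum
  -- equal.
  have h2 : ∀ w : SignedPerm n, (sgn w : ℂ) * g.coeff (-(act w ν)) = (-1) ^ n * g.coeff ν :=
    fun w => by
    have h3 : -(act w ν) = act (w.1, -w.2) ν := by
      ext i
      simp [act]
    have h4 : (sgn ((w.1, -w.2) : SignedPerm n) : ℂ) = (-1) ^ n * sgn w := by
      simp only [sgn, Pi.neg_apply, Finset.prod_neg]
      push_cast
      simp
      ring
    rw [h3, hg.coeff_act, h4]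
    linear_combination ((-1) ^ n * g.coeff ν) * sgn_mul_self w
  rw [h1, Finset.sum_congr rfl fun w _ => h2 w, Finset.sum_const, Finset.card_univ, nsmul_eq_mul]
  ring

/-! ### Strictly dominant weights -/

lemma IsAntisymm.coeff_eq_zero {g : GroupAlg n} (hg : IsAntisymm g) {κ : Wt n} {i j : Fin n}
    (hij : i ≠ j) (h : κ i = κ j) : g.coeff κ = 0 := by
  have h1 : act ((Equiv.swap i j, 1) : SignedPerm n) κ = κ := by
    ext k
    simp only [act, Equiv.symm_swap, Pi.one_apply, Units.val_one, Int.cast_one, one_mul]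
    rcases eq_or_ne k i with rfl | hi
    · simp [h]
    · rcases eq_or_ne k j with rfl | hj
      · simp [h]
      · rw [Equiv.swap_apply_of_ne_of_ne hi hj]
  have h2 := hg.coeff_act (Equiv.swap i j, 1) κ
  rw [h1] at h2
  simp [sgn, Equiv.Perm.sign_swap hij] at h2
  linear_combination h2 / 2

/-- Every weight can be moved to a weakly decreasing one with nonnegative coordinates. -/
lemma exists_act_antitone (κ : Wt n) :
    ∃ w : SignedPerm n, Antitone (act w κ) ∧ ∀ i, ∃ j, act w κ i = |κ j| := by
  set σ := Tuple.sort fun i => -|κ i| with hσ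
  have hm := Tuple.monotone_sort fun i => -|κ i|
  have key : ∀ i, act ((σ.symm, fun i => if 0 ≤ κ (σ i) then 1 else -1) : SignedPerm n) κ i =
      |κ (σ i)| := fun i => by
    simp only [act, Equiv.symm_symm]
    split_ifs with h
    · simp [abs_of_nonneg h]
    · simp [abs_of_neg (not_le.1 h)]
  refine ⟨_, fun i j hij => ?_, fun i => ⟨_, key i⟩⟩
  rw [key, key]
  have := hm hij
  simp only [Function.comp_apply] at this
  rw [← hσ] at this
  linarith

/-- Positivity of all coordinates excludes sign changes, and the remaining permutation preserves the
order of `Fin n`, hence is trivial. -/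
lemma act_eq_of_strictAnti {ν ν' : Wt n} (hν : StrictAnti ν) (hν' : StrictAnti ν')
    (h0 : ∀ i, 0 < ν i) (h0' : ∀ i, 0 < ν' i) (w : SignedPerm n) (h : act w ν = ν') :
    w = 1 := by
  have h2 : w.2 = 1 := by
    ext i
    rcases Int.units_eq_one_or (w.2 i) with h1 | h1
    · simp [h1]
    · exfalso
      have h3 := congrFun h i
      have h4 := h0 (w.1.symm i)
      have h5 := h0' i
      simp only [act, h1] at h3
      simp at h3
      linarith
  have h3 : ∀ i, ν (w.1.symm i) = ν' i := fun i => by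
    have := congrFun h i
    simpa [act, h2] using this
  have h4 : StrictMono w.1.symm := fun i j hij => by
    rw [← hν.lt_iff_gt, h3, h3]
    exact hν' hij
  have h5 : w.1.symm = 1 := Equiv.ext fun i => DFunLike.congr_fun
    (Subsingleton.elim (h4.orderIsoOfSurjective _ w.1.symm.surjective) (OrderIso.refl _)) i
  refine Prod.ext ?_ h2
  rw [← Equiv.symm_symm w.1, h5]
  rfl

lemma coeff_alternant_of_strictAnti {ν ν' : Wt n} (hν : StrictAnti ν) (hν' : StrictAnti ν')
    (h0 : ∀ i, 0 < ν i) (h0' : ∀ i, 0 < ν' i) [Decidable (ν = ν')] :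
    (alternant ν).coeff ν' = if ν = ν' then 1 else 0 := by
  classical
  have h1 : (alternant ν).coeff ν' =
      ∑ w : SignedPerm n, (sgn w : ℂ) * if act w ν = ν' then 1 else 0 := by
    rw [← coeffAt_apply, alternant, map_sum]
    refine Finset.sum_congr rfl fun w _ => ?_
    rw [map_smul, coeffAt_apply, coeff_expo, smul_eq_mul]
  have h2 : act (1 : SignedPerm n) ν = ν := by
    ext i; simp [act, ← Equiv.Perm.inv_def]
  rw [h1, Finset.sum_eq_single 1, h2]
  · simp [sgn]
  · intro w _ hw
    rw [if_neg fun h => hw (act_eq_of_strictAnti hν hν' h0 h0' w h), mul_zero]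
  · simp

lemma rho_pos (i : Fin n) : 0 < rho n i := by
  have : ((i : ℕ) : ℚ) + 1 ≤ n := by exact_mod_cast i.2
  simp only [rho]
  linarith

lemma rho_strictAnti : StrictAnti (rho n) := fun i j hij => by
  have : ((i : ℕ) : ℚ) < (j : ℕ) := by exact_mod_cast hij
  simp only [rho]
  linarith

lemma IsDominant.strictAnti_add_rho {μ : Wt n} (hμ : IsDominant μ) : StrictAnti (μ + rho n) :=
  fun _ _ hij => add_lt_add_of_le_of_lt (hμ.2.1 hij.le) (rho_strictAnti hij)

lemma IsDominant.add_rho_pos {μ : Wt n} (hμ : IsDominant μ) (i : Fin n) : 0 < (μ + rho n) i :=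
  add_pos_of_nonneg_of_pos (hμ.2.2 i) (rho_pos i)

lemma coeff_alternant_dominant (μ ν : DominantWeight n) [Decidable (μ = ν)] :
    (alternant (μ.1 + rho n)).coeff (ν.1 + rho n) = if μ = ν then 1 else 0 := by
  classical
  rw [coeff_alternant_of_strictAnti μ.2.strictAnti_add_rho ν.2.strictAnti_add_rho
    μ.2.add_rho_pos ν.2.add_rho_pos]
  simp only [add_left_inj, Subtype.ext_iff]

lemma isDominant_zero : IsDominant (0 : Wt n) :=
  ⟨Or.inl fun _ => ⟨0, by simp⟩, antitone_const, fun _ => le_rfl⟩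

lemma alternant_rho_ne_zero : alternant (rho n) ≠ 0 := fun h => by
  classical
  have := coeff_alternant_dominant (⟨0, isDominant_zero⟩ : DominantWeight n) ⟨0, isDominant_zero⟩
  simp [h] at this

/-! ### Products over pairs -/

/-- The product of `F i j` over the pairs `i < j`. -/
def pairProd {R : Type*} [CommMonoid R] {n : ℕ} (F : Fin n → Fin n → R) : R :=
  ∏ i, ∏ j, if i < j then F i j else 1

lemma pairProd_eq_prod_Ioi {R : Type*} [CommMonoid R] {n : ℕ} (F : Fin n → Fin n → R) :
    pairProd F = ∏ i, ∏ j ∈ Finset.Ioi i, F i j := by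
  refine Finset.prod_congr rfl fun i _ => ?_
  rw [← Finset.prod_filter]
  refine Finset.prod_congr ?_ fun _ _ => rfl
  ext j; simp

lemma pairProd_mul {R : Type*} [CommMonoid R] {n : ℕ} (F G : Fin n → Fin n → R) :
    pairProd (fun i j => F i j * G i j) = pairProd F * pairProd G := by
  simp only [pairProd, ← Finset.prod_mul_distrib]
  refine Finset.prod_congr rfl fun i _ => Finset.prod_congr rfl fun j _ => ?_
  split_ifs <;> simp

lemma pairProd_congr {R : Type*} [CommMonoid R] {n : ℕ} {F G : Fin n → Fin n → R}
    (h : ∀ i j, i < j → F i j = G i j) : pairProd F = pairProd G :=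
  Finset.prod_congr rfl fun i _ => Finset.prod_congr rfl fun j _ => by
    split_ifs with hij
    · exact h i j hij
    · rfl

lemma pairProd_castSucc {R : Type*} [CommMonoid R] {n : ℕ} (F : Fin (n + 1) → Fin (n + 1) → R) :
    pairProd F = pairProd (fun i j : Fin n => F i.castSucc j.castSucc) *
      ∏ i : Fin n, F i.castSucc (Fin.last n) := by
  simp only [pairProd, Fin.prod_univ_castSucc, Fin.castSucc_lt_castSucc_iff, Fin.castSucc_lt_last,
    if_true, Finset.prod_mul_distrib, lt_irrefl, if_false, mul_one]
  rw [Finset.prod_eq_one (s := Finset.univ) (f := fun x : Fin n =>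
    if Fin.last n < x.castSucc then F (Fin.last n) x.castSucc else 1), mul_one]
  intro i _
  rw [if_neg (not_lt.2 (Fin.le_last _))]

lemma prod_prod_eq_diag_mul_pairProd {R : Type*} [CommMonoid R] {n : ℕ} (F : Fin n → Fin n → R) :
    ∏ i, ∏ j, F i j = (∏ i, F i i) * pairProd fun i j => F i j * F j i := by
  have h1 : ∀ i j, F i j = (if i < j then F i j else 1) * (if j < i then F i j else 1) *
      (if i = j then F i j else 1) := fun i j => by
    rcases lt_trichotomy i j with h | h | h
    · simp [h, h.not_gt, h.ne]
    · simp [h]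
    · simp [h, h.not_gt, h.ne']
  rw [pairProd_mul, Finset.prod_congr rfl fun i _ => Finset.prod_congr rfl fun j _ => h1 i j]
  simp only [Finset.prod_mul_distrib]
  rw [Finset.prod_comm (f := fun i j => if j < i then F i j else 1), mul_comm]
  simp [pairProd]

lemma pairProd_add {R : Type*} [CommMonoid R] {n : ℕ} (F : Fin (n + n) → Fin (n + n) → R) :
    pairProd F = (∏ i : Fin n, F (i.castAdd n) (i.natAdd n)) *
      pairProd (fun i j : Fin n => F (i.castAdd n) (j.castAdd n) * F (i.natAdd n) (j.natAdd n) *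
        (F (i.castAdd n) (j.natAdd n) * F (j.castAdd n) (i.natAdd n))) := by
  rw [pairProd_mul, pairProd_mul, mul_left_comm,
    ← prod_prod_eq_diag_mul_pairProd fun i j : Fin n => F (i.castAdd n) (j.natAdd n)]
  have h1 : ∀ i j : Fin n, i.castAdd n < j.natAdd n := fun i j => by
    rw [Fin.lt_def]; simp; omega
  have h2 : ∀ i j : Fin n, (i.natAdd n < j.natAdd n) ↔ i < j := fun i j => by
    rw [Fin.lt_def, Fin.lt_def, Fin.val_natAdd, Fin.val_natAdd]
    omega
  have h3 : ∀ i j : Fin n, (i.castAdd n < j.castAdd n) ↔ i < j := fun i j => by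
    rw [Fin.lt_def, Fin.lt_def, Fin.val_castAdd, Fin.val_castAdd]
  simp only [pairProd, Fin.prod_univ_add, h1, (h1 _ _).not_gt, h2, h3, if_true, if_false,
    Finset.prod_mul_distrib, Finset.prod_const_one, mul_one]
  rw [mul_assoc, mul_comm (∏ x, ∏ y, F (Fin.castAdd n x) (Fin.natAdd n y))]

/-- The pairs of `2n + 1` variables, the variables being grouped as `n` pairs and one more. -/
lemma pairProd_double {R : Type*} [CommMonoid R] {n : ℕ}
    (F : Fin (n + n + 1) → Fin (n + n + 1) → R) :
    pairProd F =
      (∏ i : Fin n, F (i.castAdd n).castSucc (i.natAdd n).castSucc *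
        (F (i.castAdd n).castSucc (Fin.last _) * F (i.natAdd n).castSucc (Fin.last _))) *
      pairProd (fun i j : Fin n =>
        F (i.castAdd n).castSucc (j.castAdd n).castSucc *
          F (i.natAdd n).castSucc (j.natAdd n).castSucc *
        (F (i.castAdd n).castSucc (j.natAdd n).castSucc *
          F (j.castAdd n).castSucc (i.natAdd n).castSucc)) := by
  rw [pairProd_castSucc, pairProd_add, Fin.prod_univ_add]
  simp only [Finset.prod_mul_distrib]
  exact mul_right_comm _ _ _

lemma det_vandermonde_eq_pairProd {R : Type*} [CommRing R] {n : ℕ} (v : Fin n → R) :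
    (Matrix.vandermonde v).det = pairProd fun i j => v j - v i := by
  rw [Matrix.det_vandermonde, pairProd_eq_prod_Ioi]

/-! ### Determinants of values of polynomials -/

/-- Subtracting the last row makes every other row divisible by x_i - a, a being the last point. The
quotient rows are again values of polynomials, so expansion along the last row allows induction. No
factoriality of the ring is needed. -/
lemma pairProd_dvd_det_eval {R : Type*} [CommRing R] : ∀ {n : ℕ} (x : Fin n → R)
    (p : Fin n → R[X]),
    (pairProd fun i j => x j - x i) ∣ (Matrix.of fun i j => (p j).eval (x i)).det
  | 0, x, p => by simp [pairProd]
  | n + 1, x, p => by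
    have hq : ∀ (a b : R) (r : R[X]),
        r.eval b = (b - a) * (r /ₘ (Polynomial.X - Polynomial.C a)).eval b + r.eval a := fun a b r => by
      have h := congrArg (Polynomial.eval b) (Polynomial.modByMonic_add_div r (Polynomial.X - Polynomial.C a))
      rw [Polynomial.modByMonic_X_sub_C_eq_C_eval] at h
      simp at h
      linear_combination -h
    set t : Fin n → R := fun i => x i.castSucc with ht
    set a := x (Fin.last n) with ha
    have h1 : (Matrix.of fun i j => (p j).eval (x i)).det =
        (Matrix.of fun i j => (Fin.snoc (fun i : Fin n => t i - a) 1 : Fin (n + 1) → R) i *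
          (Fin.snoc (α := fun _ => R) (fun i : Fin n =>
            (p j /ₘ (Polynomial.X - Polynomial.C a)).eval (t i)) ((p j).eval a) i)).det := by
      refine Matrix.det_eq_of_forall_row_eq_smul_add_const
        (Fin.snoc (α := fun _ => R) (fun _ => (1 : R)) 0) (Fin.last n) (by simp) fun i j => ?_
      refine Fin.lastCases ?_ (fun i => ?_) i
      · simp [ha]
      · simp only [Matrix.of_apply, Fin.snoc_castSucc, Fin.snoc_last, one_mul]
        exact hq a (t i) (p j)
    rw [h1]
    have h2 := Matrix.det_mul_column (Fin.snoc (fun i : Fin n => t i - a) 1 : Fin (n + 1) → R)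
      (Matrix.of fun i j => (Fin.snoc (α := fun _ => R) (fun i : Fin n =>
            (p j /ₘ (Polynomial.X - Polynomial.C a)).eval (t i)) ((p j).eval a) i))
    simp only [Matrix.of_apply] at h2
    rw [h2, Fin.prod_univ_castSucc, pairProd_castSucc, mul_comm (pairProd _)]
    simp only [Fin.snoc_castSucc, Fin.snoc_last, mul_one]
    refine mul_dvd_mul ?_ ?_
    · rw [show (∏ i : Fin n, (t i - a)) = (∏ i : Fin n, (-1 : R)) * ∏ i : Fin n, (a - t i) by
        rw [← Finset.prod_mul_distrib]
        exact Finset.prod_congr rfl fun i _ => by ring]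
      exact Dvd.intro_left _ rfl
    · rw [Matrix.det_succ_row _ (Fin.last n)]
      refine Finset.dvd_sum fun j _ => Dvd.dvd.mul_left ?_ _
      have h3 := pairProd_dvd_det_eval t fun k => p (j.succAbove k) /ₘ (Polynomial.X - Polynomial.C a)
      convert h3 using 2
      ext i k
      simp

/-- The polynomials with `p_k(u^2 + u^{-2}) (u - u^{-1}) = u^{2k+1} - u^{-2k-1}`. -/
def oddChar (R : Type*) [CommRing R] : ℕ → R[X]
  | 0 => 1
  | 1 => Polynomial.X + 1
  | k + 2 => Polynomial.X * oddChar R (k + 1) - oddChar R k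

lemma eval_oddChar {R : Type*} [CommRing R] {u v : R} (h : u * v = 1) : ∀ k : ℕ,
    (oddChar R k).eval (u ^ 2 + v ^ 2) * (u - v) = u ^ (2 * k + 1) - v ^ (2 * k + 1)
  | 0 => by simp [oddChar]
  | 1 => by
    simp [oddChar]
    linear_combination (v - u) * h
  | k + 2 => by
    have h1 := eval_oddChar h (k + 1)
    have h2 := eval_oddChar h k
    simp only [oddChar, Polynomial.eval_sub, Polynomial.eval_mul, Polynomial.eval_X]
    rw [sub_mul, mul_assoc, h1, h2]
    have h3 : u ^ 2 * v ^ 2 = 1 := by rw [← mul_pow, h, one_pow]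
    rw [show 2 * (k + 2) + 1 = 2 * k + 1 + 4 by ring, show 2 * (k + 1) + 1 = 2 * k + 1 + 2 by ring]
    linear_combination (u ^ (2 * k + 1) - v ^ (2 * k + 1)) * h3

lemma isMonicOfDegree_recursion {R : Type*} [CommRing R] [Nontrivial R] {p r : R[X]} {k : ℕ} {s c : R}
    (hp : p.IsMonicOfDegree (k + 1)) (hr : r.IsMonicOfDegree k) :
    ((Polynomial.X + Polynomial.C s) * p + Polynomial.C c * r).IsMonicOfDegree (k + 2) := by
  have h1 : ((Polynomial.X + Polynomial.C s) * p).IsMonicOfDegree (k + 2) := by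
    rw [show k + 2 = 1 + (k + 1) by omega]
    exact (Polynomial.isMonicOfDegree_X_add_one s).mul hp
  refine h1.add_right ?_
  refine (Polynomial.natDegree_C_mul_le c r).trans_lt ?_
  rw [hr.natDegree_eq]
  omega

lemma isMonicOfDegree_oddChar (R : Type*) [CommRing R] [Nontrivial R] :
    ∀ k : ℕ, (oddChar R k).IsMonicOfDegree k
  | 0 => by simp [oddChar]
  | 1 => by
    simpa [oddChar] using Polynomial.isMonicOfDegree_X_add_one (1 : R)
  | k + 2 => by
    have := isMonicOfDegree_recursion (s := 0) (c := -1) (isMonicOfDegree_oddChar R (k + 1))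
      (isMonicOfDegree_oddChar R k)
    simpa [oddChar, sub_eq_add_neg] using this

lemma det_eval_of_isMonicOfDegree {R : Type*} [CommRing R] {n : ℕ} (x : Fin n → R)
    (p : ℕ → R[X]) (hp : ∀ k, (p k).IsMonicOfDegree k) :
    (Matrix.of fun i j : Fin n => (p j).eval (x i)).det = pairProd fun i j => x j - x i := by
  rw [← det_vandermonde_eq_pairProd,
    Matrix.det_eval_matrixOfPolynomials_eq_det_vandermonde x (fun j => p j)
      (fun j => (hp j).natDegree_eq) (fun j => (hp j).monic)]

/-- The polynomials with `p_k(u^2 + u^{-2}) (u^2 - u^{-2}) = u^{2k} - u^{-2k}`. -/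
def evenChar (R : Type*) [CommRing R] : ℕ → R[X]
  | 0 => 0
  | 1 => 1
  | k + 2 => Polynomial.X * evenChar R (k + 1) - evenChar R k

lemma eval_evenChar {R : Type*} [CommRing R] {u v : R} (h : u * v = 1) : ∀ k : ℕ,
    (evenChar R k).eval (u ^ 2 + v ^ 2) * ((u - v) * (u + v)) = u ^ (2 * k) - v ^ (2 * k)
  | 0 => by simp [evenChar]
  | 1 => by
    simp [evenChar]
    ring
  | k + 2 => by
    have h1 := eval_evenChar h (k + 1)
    have h2 := eval_evenChar h k
    simp only [evenChar, Polynomial.eval_sub, Polynomial.eval_mul, Polynomial.eval_X]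
    rw [sub_mul, mul_assoc, h1, h2]
    have h3 : u ^ 2 * v ^ 2 = 1 := by rw [← mul_pow, h, one_pow]
    rw [show 2 * (k + 2) = 2 * k + 4 by ring, show 2 * (k + 1) = 2 * k + 2 by ring]
    linear_combination (u ^ (2 * k) - v ^ (2 * k)) * h3

/-! ### Alternants as determinants -/

/-- The sign changes come from multiplying out the two-term entries, the permutations from the
Leibniz formula. -/
lemma alternant_eq_det (ν : Wt n) : alternant ν =
    (Matrix.of fun i j : Fin n => expo (Pi.single i (ν j)) - expo (Pi.single i (-ν j))).det := by
  classical
  have h1 : ∀ i j : Fin n, expo (Pi.single i (ν j) : Wt n) - expo (Pi.single i (-ν j)) =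
      ∑ ε : ℤˣ, ((ε : ℤ) : ℂ) • expo (Pi.single i (((ε : ℤ) : ℚ) * ν j)) := fun i j => by
    have : (Finset.univ : Finset ℤˣ) = {1, -1} := rfl
    rw [this, Finset.sum_pair (by decide)]
    simp [sub_eq_add_neg]
  rw [Matrix.det_apply', alternant, Fintype.sum_prod_type]
  refine Finset.sum_congr rfl fun σ _ => ?_
  have h2 : ∏ i, (Matrix.of fun i j : Fin n =>
      expo (Pi.single i (ν j) : Wt n) - expo (Pi.single i (-ν j))) (σ i) i =
      ∑ ε : Fin n → ℤˣ, (∏ i, (((ε i : ℤˣ) : ℤ) : ℂ)) • expo (act (σ, ε) ν) := by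
    rw [← Equiv.prod_comp σ.symm]
    simp only [Matrix.of_apply, Equiv.apply_symm_apply, h1]
    rw [Finset.prod_univ_sum, Fintype.piFinset_univ]
    refine Finset.sum_congr rfl fun ε _ => ?_
    rw [Finset.prod_smul, ← expo_sum]
    congr 2
    ext i
    simp [act, Finset.sum_apply, Pi.single_apply]
  rw [h2, Finset.mul_sum]
  refine Finset.sum_congr rfl fun ε _ => ?_
  simp only [sgn]
  push_cast
  rw [mul_smul]
  rcases Int.units_eq_one_or (Equiv.Perm.sign σ) with h | h <;> simp [h]

/-- The formal exponential of `e_i / 2`. -/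
def halfPos (i : Fin n) : GroupAlg n := expo (Pi.single i (1 / 2))

/-- The formal exponential of `-e_i / 2`. -/
def halfNeg (i : Fin n) : GroupAlg n := expo (Pi.single i (-(1 / 2)))

lemma halfPos_mul_halfNeg (i : Fin n) : halfPos i * halfNeg i = 1 := by
  rw [halfPos, halfNeg, ← expo_add, ← Pi.single_add, add_neg_cancel, Pi.single_zero, expo_zero]

lemma expo_single_pow (i : Fin n) (a : ℚ) (k : ℕ) :
    expo (Pi.single i a : Wt n) ^ k = expo (Pi.single i (k * a)) := by
  induction k with
  | zero => simp [expo_zero]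
  | succ k ih =>
    rw [pow_succ, ih, ← expo_add, ← Pi.single_add]
    congr 2
    push_cast
    ring

lemma halfPos_pow (i : Fin n) (k : ℕ) : halfPos i ^ k = expo (Pi.single i ((k : ℚ) / 2)) := by
  rw [halfPos, expo_single_pow]
  congr 2
  ring

lemma halfNeg_pow (i : Fin n) (k : ℕ) : halfNeg i ^ k = expo (Pi.single i (-((k : ℚ) / 2))) := by
  rw [halfNeg, expo_single_pow]
  congr 2
  ring

lemma alternant_eq_det_pow {ν : Wt n} {m : Fin n → ℕ} (h : ∀ j, ν j = (m j : ℚ) / 2) :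
    alternant ν = (Matrix.of fun i j : Fin n => halfPos i ^ m j - halfNeg i ^ m j).det := by
  rw [alternant_eq_det]
  simp only [halfPos_pow, halfNeg_pow, h]

/-- `x_i + x_i^{-1}`. -/
def xSum (i : Fin n) : GroupAlg n := halfPos i ^ 2 + halfNeg i ^ 2

lemma det_pow_odd (κ : Fin n → ℕ) :
    (Matrix.of fun i j : Fin n => halfPos i ^ (2 * κ j + 1) - halfNeg i ^ (2 * κ j + 1)).det =
      (∏ i : Fin n, (halfPos i - halfNeg i)) *
        (Matrix.of fun i j : Fin n => (oddChar (GroupAlg n) (κ j)).eval (xSum i)).det := by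
  have h := Matrix.det_mul_column (fun i : Fin n => halfPos i - halfNeg i)
    (Matrix.of fun i j : Fin n => (oddChar (GroupAlg n) (κ j)).eval (xSum i))
  rw [← h]
  congr 1
  ext1 i j
  simp only [Matrix.of_apply]
  rw [← eval_oddChar (halfPos_mul_halfNeg i), mul_comm, xSum]

lemma det_pow_even (κ : Fin n → ℕ) :
    (Matrix.of fun i j : Fin n => halfPos i ^ (2 * κ j) - halfNeg i ^ (2 * κ j)).det =
      (∏ i : Fin n, (halfPos i - halfNeg i)) * ((∏ i : Fin n, (halfPos i + halfNeg i)) *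
        (Matrix.of fun i j : Fin n => (evenChar (GroupAlg n) (κ j)).eval (xSum i)).det) := by
  have h := Matrix.det_mul_column
    (fun i : Fin n => (halfPos i - halfNeg i) * (halfPos i + halfNeg i))
    (Matrix.of fun i j : Fin n => (evenChar (GroupAlg n) (κ j)).eval (xSum i))
  rw [Finset.prod_mul_distrib, mul_assoc] at h
  rw [← h]
  congr 1
  ext1 i j
  simp only [Matrix.of_apply]
  rw [← eval_evenChar (halfPos_mul_halfNeg i), mul_comm, xSum]

/-- The sign of the order reversing permutation of `n` letters. -/
def revSign (n : ℕ) : ℂ := ((Equiv.Perm.sign (Fin.revPerm : Equiv.Perm (Fin n)) : ℤ) : ℂ)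

lemma revSign_mul_self (n : ℕ) : revSign n * revSign n = 1 := by
  rw [revSign]
  rcases Int.units_eq_one_or (Equiv.Perm.sign (Fin.revPerm : Equiv.Perm (Fin n))) with h | h <;>
    simp [h]

/-- An alternant of half-odd exponents, listed increasingly. -/
lemma alternant_eq_revSign_smul {ν : Wt n} {κ : Fin n → ℕ}
    (h : ∀ j, ν j = ((2 * κ j.rev + 1 : ℕ) : ℚ) / 2) :
    alternant ν = revSign n • ((∏ i : Fin n, (halfPos i - halfNeg i)) *
      (Matrix.of fun i j : Fin n => (oddChar (GroupAlg n) (κ j)).eval (xSum i)).det) := by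
  rw [alternant_eq_det_pow h, ← det_pow_odd]
  have h1 := Matrix.det_permute' (Fin.revPerm : Equiv.Perm (Fin n))
    (Matrix.of fun i j : Fin n => halfPos i ^ (2 * κ j + 1) - halfNeg i ^ (2 * κ j + 1))
  refine Eq.trans (congrArg Matrix.det ?_) (h1.trans ?_)
  · ext1 i j
    simp
  · rw [revSign]
    rcases Int.units_eq_one_or (Equiv.Perm.sign (Fin.revPerm : Equiv.Perm (Fin n))) with h | h <;>
    simp [h]

lemma rho_eq (j : Fin n) : rho n j = ((2 * (j.rev : ℕ) + 1 : ℕ) : ℚ) / 2 := by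
  have h : ((j.rev : ℕ) : ℚ) = n - (j + 1) := by
    rw [Fin.val_rev, Nat.cast_sub (by omega)]
    push_cast
    ring
  rw [rho]
  push_cast
  rw [h]
  ring

lemma alternant_rho : alternant (rho n) = revSign n • ((∏ i : Fin n, (halfPos i - halfNeg i)) *
    pairProd fun i j : Fin n => xSum j - xSum i) := by
  rw [alternant_eq_revSign_smul (κ := fun j => j) rho_eq,
    det_eval_of_isMonicOfDegree _ _ (isMonicOfDegree_oddChar _)]

/-- The alternant of `ρ` divides that of every `μ + ρ`. -/
lemma alternant_rho_dvd {μ : Wt n} (hμ : IsDominant μ) :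
    alternant (rho n) ∣ alternant (μ + rho n) := by
  have hs : alternant (rho n) ∣ (∏ i : Fin n, (halfPos i - halfNeg i)) *
      pairProd fun i j : Fin n => xSum j - xSum i := by
    refine ⟨algebraMap ℂ _ (revSign n), ?_⟩
    rw [alternant_rho, mul_comm _ (algebraMap ℂ _ _), ← Algebra.smul_def, smul_smul, revSign_mul_self, one_smul]
  refine hs.trans ?_
  -- If μ is integral, then μ + ρ is half-odd and `oddChar` applies; if μ is half-odd, then μ + ρ is
  -- integral and `evenChar` applies, with the extra factor ∏ (x_i^{1/2} + x_i^{-1/2}).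
  rcases hμ.1 with h | h
  · choose k hk using h
    have hk0 : ∀ j, 0 ≤ k j := fun j => by
      have := hμ.2.2 j
      rw [hk] at this
      exact_mod_cast this
    lift k to Fin n → ℕ using hk0
    rw [alternant_eq_det_pow (m := fun j => 2 * (k j + (j.rev : ℕ)) + 1) fun j => ?_,
      det_pow_odd fun j => k j + (j.rev : ℕ)]
    · exact mul_dvd_mul_left _ (pairProd_dvd_det_eval _ _)
    · rw [Pi.add_apply, hk, rho_eq]
      push_cast
      ring
  · choose k hk using h
    have hk0 : ∀ j, 0 ≤ k j := fun j => by
      have := hμ.2.2 j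
      rw [hk] at this
      by_contra h
      have h2 : (k j : ℚ) ≤ -1 := by exact_mod_cast (by omega : k j ≤ -1)
      linarith
    lift k to Fin n → ℕ using hk0
    rw [alternant_eq_det_pow (m := fun j => 2 * (k j + (j.rev : ℕ) + 1)) fun j => ?_,
      det_pow_even fun j => k j + (j.rev : ℕ) + 1]
    · exact mul_dvd_mul_left _ (Dvd.dvd.mul_left (pairProd_dvd_det_eval _ _) _)
    · rw [Pi.add_apply, hk, rho_eq]
      push_cast
      ring

lemma chi_mul_alternant (μ : DominantWeight n) :
    chi μ * alternant (rho n) = alternant (μ.1 + rho n) := by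
  have h : ∃ x : GroupAlg n, x * alternant (rho n) = alternant (μ.1 + rho n) := by
    obtain ⟨c, hc⟩ := alternant_rho_dvd μ.2
    exact ⟨c, by rw [hc, mul_comm]⟩
  rw [chi, dif_pos h]
  exact h.choose_spec

/-! ### The exterior powers of the vector representation -/

/-- Raising the n - k largest coordinates of ρ by 1 opens a gap at k: the exponents become those of
0, …, n with k omitted, as in the minor without column k. -/
lemma omegaWeight_add_rho (k : Fin (n + 1)) (j : Fin n) :
    ((omegaWeight n (n - k)).1 + rho n) j = ((2 * (k.succAbove j.rev : ℕ) + 1 : ℕ) : ℚ) / 2 := by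
  rw [Pi.add_apply, rho_eq, omegaWeight]
  simp only
  have hj : (j.rev : ℕ) = n - (j + 1) := Fin.val_rev j
  have hk := k.2
  split_ifs with h
  · rw [Fin.succAbove_of_le_castSucc _ _ (by rw [Fin.le_def, Fin.val_castSucc, hj]; omega),
      Fin.val_succ]
    push_cast
    ring
  · rw [Fin.succAbove_of_castSucc_lt _ _ (by rw [Fin.lt_def, Fin.val_castSucc, hj]; omega),
      Fin.val_castSucc]
    ring

/-- The dual Cauchy identity: the generating function of the characters of the exterior powers
of the `(2n+1)`-dimensional representation, multiplied by the denominator. -/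
lemma alternant_rho_mul_prod {z : ℂ} (hz : z ≠ 0) :
    alternant (rho n) * ((1 + z) •
      ∏ i : Fin n, (1 + z • halfPos i ^ 2) * (1 + z • halfNeg i ^ 2)) =
    ∑ k : Fin (n + 1), (z ^ (n - k : ℕ) + z ^ (n + k + 1 : ℕ)) •
      alternant ((omegaWeight n (n - k)).1 + rho n) := by
  set A : ℂ →+* GroupAlg n := algebraMap ℂ (GroupAlg n) with hA
  -- Chosen so that (1 + z x)(1 + z x⁻¹) = -z (Z - (x + x⁻¹)).
  set Z : ℂ := -(z + z⁻¹) with hZ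
  have hodd : ∀ k : ℕ, k ≤ n → (oddChar ℂ k).eval Z * ((1 + z) * z ^ n) =
      (-1) ^ k * (z ^ (n - k) + z ^ (n + k + 1)) := by
    intro k
    induction k using Nat.strong_induction_on with
    | _ k ih =>
      match k with
      | 0 => intro _; simp [oddChar]; ring
      | 1 =>
        intro h1
        obtain ⟨m, rfl⟩ := Nat.exists_eq_add_of_le' h1
        simp [oddChar, hZ]
        field_simp
        ring
      | k + 2 =>
        intro h1
        obtain ⟨m, rfl⟩ := Nat.exists_eq_add_of_le' h1
        have e1 := ih (k + 1) (by omega) (by omega)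
        have e2 := ih k (by omega) (by omega)
        simp only [oddChar, Polynomial.eval_sub, Polynomial.eval_mul, Polynomial.eval_X]
        rw [sub_mul, mul_assoc, e1, e2, hZ]
        rw [show m + (k + 2) - (k + 2) = m by omega, show m + (k + 2) - (k + 1) = m + 1 by omega,
          show m + (k + 2) - k = m + 2 by omega]
        field_simp
        ring
  have hmap : ∀ k : ℕ, (oddChar (GroupAlg n) k).eval (A Z) = A ((oddChar ℂ k).eval Z) := by
    intro k
    induction k using Nat.strong_induction_on with
    | _ k ih =>
      match k with
      | 0 => simp [oddChar]
      | 1 => simp [oddChar]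
      | k + 2 =>
        simp only [oddChar, Polynomial.eval_sub, Polynomial.eval_mul, Polynomial.eval_X, map_sub,
          map_mul, ih (k + 1) (by omega), ih k (by omega)]
  -- A Vandermonde determinant at the n+1 points x_i + x_i⁻¹ and Z, then expanded along the row of
  -- Z; the minors are alternants and the entries of that row are given by `hodd`.
  have hdet := det_eval_of_isMonicOfDegree
    (Fin.snoc (α := fun _ => GroupAlg n) (fun i : Fin n => xSum i) (A Z)) _
    (isMonicOfDegree_oddChar (GroupAlg n))
  rw [pairProd_castSucc, Matrix.det_succ_row _ (Fin.last n)] at hdet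
  simp only [Fin.snoc_castSucc, Fin.snoc_last, Matrix.of_apply, Fin.val_last, hmap] at hdet
  have hsub : ∀ k : Fin (n + 1), ((Matrix.of fun i j : Fin (n + 1) =>
      (oddChar (GroupAlg n) j).eval (Fin.snoc (α := fun _ => GroupAlg n)
        (fun i : Fin n => xSum i) (A Z) i)).submatrix (Fin.last n).succAbove k.succAbove) =
      Matrix.of fun i j : Fin n => (oddChar (GroupAlg n) (k.succAbove j)).eval (xSum i) := by
    intro k
    ext1 i j
    simp
  simp only [hsub] at hdet
  have hprod : (1 + z) • ∏ i : Fin n, (1 + z • halfPos i ^ 2) * (1 + z • halfNeg i ^ 2) =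
      ((1 + z) * z ^ n * (-1) ^ n) • ∏ i : Fin n, (A Z - xSum i) := by
    rw [mul_smul, mul_smul]
    congr 1
    have : ∀ i : Fin n, (1 + z • halfPos i ^ 2) * (1 + z • halfNeg i ^ 2) =
        (z * (-1)) • (A Z - xSum i) := fun i => by
      have h1 : (halfPos i ^ 2 * halfNeg i ^ 2) = 1 := by
        rw [← mul_pow, halfPos_mul_halfNeg, one_pow]
      have h2 : A z * A Z = -A z ^ 2 - 1 := by
        rw [← map_mul, ← map_pow, ← map_one A, ← map_neg, ← map_sub, hZ]
        congr 1
        field_simp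
        ring
      simp only [Algebra.smul_def, ← hA, xSum, map_mul, map_neg, map_one]
      linear_combination A z ^ 2 * h1 + h2
    rw [Finset.prod_congr rfl fun i _ => this i, Finset.prod_smul, Finset.prod_const,
      Finset.card_univ, Fintype.card_fin, mul_pow, mul_smul]
  rw [hprod, alternant_rho, smul_mul_smul_comm,
    mul_assoc (∏ i : Fin n, (halfPos i - halfNeg i)), ← hdet, Finset.mul_sum,
    Finset.smul_sum]
  refine Finset.sum_congr rfl fun k _ => ?_
  rw [alternant_eq_revSign_smul (κ := fun j => (k.succAbove j : ℕ)) (omegaWeight_add_rho k)]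
  simp only [Algebra.smul_def, ← hA]
  have h3 := congrArg A (hodd k (by omega))
  simp only [map_mul, map_pow, map_add, map_neg, map_one] at h3 ⊢
  generalize (Matrix.of fun i j : Fin n =>
    (oddChar (GroupAlg n) (k.succAbove j)).eval (xSum i)).det = D
  generalize (∏ i : Fin n, (halfPos i - halfNeg i)) = H at *
  have h4 : ((-1 : GroupAlg n) ^ n) * (-1) ^ (n + (k : ℕ)) * (-1) ^ (k : ℕ) = 1 := by
    rw [mul_assoc, ← pow_add, ← pow_add]
    exact Even.neg_one_pow ⟨n + k, by ring⟩
  linear_combination (A (revSign n) * (-1) ^ n * H * (-1) ^ (n + (k : ℕ)) * D) * h3 +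
    (A (revSign n) * H * D * (A z ^ (n - (k : ℕ)) + A z ^ (n + (k : ℕ) + 1))) * h4

/-! ### The functional dividing by `∏ (x_i - x_i⁻¹)` and taking the constant term -/

open Classical in
/-- The constant term of `x^r / (x - x⁻¹)`, expanded in `x⁻¹`. -/
def oddPos (r : ℚ) : ℂ := if ∃ j : ℕ, r = 2 * j + 1 then 1 else 0

lemma oddPos_intCast (d : ℤ) : oddPos d = if 0 < d ∧ Odd d then 1 else 0 := by
  classical
  rw [oddPos]
  refine if_congr ⟨?_, ?_⟩ rfl rfl
  · rintro ⟨j, hj⟩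
    have h : d = 2 * j + 1 := by exact_mod_cast hj
    exact ⟨by omega, ⟨j, h⟩⟩
  · rintro ⟨h0, k, hk⟩
    refine ⟨k.toNat, ?_⟩
    have h : ((k.toNat : ℕ) : ℤ) = k := Int.toNat_of_nonneg (by omega)
    have h2 : d = 2 * (k.toNat : ℤ) + 1 := by rw [h]; exact hk
    exact_mod_cast h2

lemma oddPos_add_one_sub (r : ℚ) : oddPos (r + 1) - oddPos (r - 1) = if r = 0 then 1 else 0 := by
  classical
  have h1 : (∃ j : ℕ, r - 1 = 2 * j + 1) → ∃ j : ℕ, r + 1 = 2 * j + 1 := by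
    rintro ⟨j, hj⟩
    exact ⟨j + 1, by push_cast; linarith⟩
  rw [oddPos, oddPos]
  by_cases h0 : r = 0
  · subst h0
    rw [if_pos ⟨0, by simp⟩, if_neg, if_pos rfl, sub_zero]
    rintro ⟨j, hj⟩
    have : (0 : ℚ) ≤ j := Nat.cast_nonneg j
    linarith
  · rw [if_neg h0]
    by_cases h2 : ∃ j : ℕ, r + 1 = 2 * j + 1
    · rw [if_pos h2, if_pos, sub_self]
      obtain ⟨j, hj⟩ := h2
      rcases j with _ | j
      · exact absurd (by push_cast at hj; linarith) h0
      · exact ⟨j, by push_cast at hj; linarith⟩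
    · rw [if_neg h2, if_neg fun h => h2 (h1 h), sub_zero]

/-- The functional `f ↦ CT (f / ∏ (x_i - x_i⁻¹))`. -/
def oddTerm (n : ℕ) : GroupAlg n →ₗ[ℂ] ℂ where
  toFun f := Finsupp.linearCombination ℂ (fun μ : Wt n => ∏ k, oddPos (μ k)) f.coeff
  map_add' f g := by rw [AddMonoidAlgebra.coeff_add, map_add]
  map_smul' c f := by rw [AddMonoidAlgebra.coeff_smul, map_smul, RingHom.id_apply]

lemma oddTerm_expo (μ : Wt n) : oddTerm n (expo μ) = ∏ k, oddPos (μ k) := by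
  simp [oddTerm, expo]

/-- After multiplying out over signs the sum factors over the coordinates, and each factor is the
telescoping difference of `oddPos_add_one_sub`. -/
lemma oddTerm_mul_prod (f : GroupAlg n) :
    oddTerm n (f * ∏ i : Fin n, (halfPos i ^ 2 - halfNeg i ^ 2)) = f.coeff 0 := by
  classical
  suffices h : oddTerm n ∘ₗ LinearMap.mulRight ℂ (∏ i : Fin n, (halfPos i ^ 2 - halfNeg i ^ 2)) =
      coeffAt 0 from LinearMap.congr_fun h f
  refine linearMap_ext_expo fun μ => ?_
  have h1 : ∀ i : Fin n, halfPos i ^ 2 - halfNeg i ^ 2 =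
      ∑ ε : ℤˣ, ((ε : ℤ) : ℂ) • expo (Pi.single i ((ε : ℤ) : ℚ) : Wt n) := fun i => by
    have : (Finset.univ : Finset ℤˣ) = {1, -1} := rfl
    rw [this, Finset.sum_pair (by decide), halfPos_pow, halfNeg_pow]
    norm_num [sub_eq_add_neg]
  have h2 : ∀ r : ℚ, (if r = 0 then (1 : ℂ) else 0) =
      ∑ ε : ℤˣ, ((ε : ℤ) : ℂ) * oddPos (r + ((ε : ℤ) : ℚ)) := fun r => by
    have : (Finset.univ : Finset ℤˣ) = {1, -1} := rfl
    rw [this, Finset.sum_pair (by decide), ← oddPos_add_one_sub]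
    simp [sub_eq_add_neg]
  simp only [LinearMap.comp_apply, LinearMap.mulRight_apply, h1, coeffAt_apply, coeff_expo]
  rw [Finset.prod_univ_sum, Fintype.piFinset_univ, Finset.mul_sum, map_sum]
  have h3 : (if μ = 0 then (1 : ℂ) else 0) = ∏ i, if μ i = 0 then (1 : ℂ) else 0 := by
    by_cases h : μ = 0
    · simp [h]
    · obtain ⟨i, hi⟩ := Function.ne_iff.1 h
      rw [if_neg h, Finset.prod_eq_zero (Finset.mem_univ i) (if_neg hi)]
  rw [h3, Finset.prod_congr rfl fun i _ => h2 (μ i), Finset.prod_univ_sum, Fintype.piFinset_univ]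
  refine Finset.sum_congr rfl fun ε _ => ?_
  rw [Finset.prod_smul, ← expo_sum, mul_smul_comm, ← expo_add, map_smul, oddTerm_expo,
    Finset.prod_mul_distrib, smul_eq_mul]
  congr 1
  refine Finset.prod_congr rfl fun k _ => ?_
  simp [Finset.sum_apply, Pi.single_apply]

/-! ### The weights of the vector representation -/

/-- The weights `e_i`, `-e_i` and `0` of the vector representation. -/
def vecWt (n : ℕ) : Fin (n + n + 1) → Wt n :=
  Fin.snoc (α := fun _ => Wt n)
    (Fin.append (fun i => Pi.single i 1) (fun i => Pi.single i (-1))) 0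

lemma vecWt_castAdd (i : Fin n) : vecWt n (i.castAdd n).castSucc = Pi.single i 1 := by
  rw [vecWt, Fin.snoc_castSucc, Fin.append_left]

lemma vecWt_natAdd (i : Fin n) : vecWt n (i.natAdd n).castSucc = Pi.single i (-1) := by
  rw [vecWt, Fin.snoc_castSucc, Fin.append_right]

lemma vecWt_last : vecWt n (Fin.last (n + n)) = 0 := by
  rw [vecWt, Fin.snoc_last]

/-- The powers of the exponentials of the weights of the vector representation. -/
def vecPow (d : ℤ) (i : Fin (n + n + 1)) : GroupAlg n := expo ((d : ℚ) • vecWt n i)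

lemma vecPow_add (c d : ℤ) (i : Fin (n + n + 1)) :
    vecPow (c + d) i = vecPow c i * vecPow d i := by
  rw [vecPow, vecPow, vecPow, ← expo_add, ← add_smul, Int.cast_add]

lemma vecPow_zero (i : Fin (n + n + 1)) : vecPow 0 i = 1 := by
  simp [vecPow, expo_zero]

lemma vecPow_last (d : ℤ) : vecPow d (Fin.last (n + n)) = 1 := by
  simp [vecPow, vecWt_last, expo_zero]

lemma vecPow_one_castAdd (i : Fin n) : vecPow 1 (i.castAdd n).castSucc = halfPos i ^ 2 := by
  rw [halfPos_pow, vecPow, vecWt_castAdd]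
  simp

lemma vecPow_one_natAdd (i : Fin n) : vecPow 1 (i.natAdd n).castSucc = halfNeg i ^ 2 := by
  rw [halfNeg_pow, vecPow, vecWt_natAdd]
  simp

lemma vecPow_neg_one_castAdd (i : Fin n) : vecPow (-1) (i.castAdd n).castSucc = halfNeg i ^ 2 := by
  rw [halfNeg_pow, vecPow, vecWt_castAdd]
  simp [← Pi.single_neg]

lemma vecPow_neg_one_natAdd (i : Fin n) : vecPow (-1) (i.natAdd n).castSucc = halfPos i ^ 2 := by
  rw [halfPos_pow, vecPow, vecWt_natAdd, ← Pi.single_smul]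
  simp

lemma halfPos_sq_mul_halfNeg_sq (i : Fin n) : halfPos i ^ 2 * halfNeg i ^ 2 = 1 := by
  rw [← mul_pow, halfPos_mul_halfNeg, one_pow]

/-- `oddTerm` of a determinant, as an alternating map of its rows. -/
def oddDet (n : ℕ) : (Fin (n + n + 1) → GroupAlg n) [⋀^Fin (n + n + 1)]→ₗ[ℂ] ℂ :=
  { (oddTerm n).compMultilinearMap ((Matrix.detRowAlternating (R := GroupAlg n)
      (n := Fin (n + n + 1))).toMultilinearMap.restrictScalars ℂ) with
    map_eq_zero_of_eq' := fun v i j hv hij => by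
      have := Matrix.det_zero_of_row_eq (M := Matrix.of v) hij hv
      change oddTerm n (Matrix.det (Matrix.of v)) = 0
      rw [this, map_zero] }

lemma oddDet_apply (v : Fin (n + n + 1) → Fin (n + n + 1) → GroupAlg n) :
    oddDet n v = oddTerm n (Matrix.of v).det := rfl

/-- In a Leibniz term the exponent of x_k is the difference of the l-values assigned to the columns
x_k and x_k⁻¹; the column of weight 0 contributes nothing. -/
lemma oddDet_vecPow (l : Fin (n + n + 1) → ℤ) : oddDet n (fun j => vecPow (l j)) =
    ∑ σ : Equiv.Perm (Fin (n + n + 1)), ((Equiv.Perm.sign σ : ℤ) : ℂ) *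
      ∏ k : Fin n, oddPos ((l (σ (k.castAdd n).castSucc) - l (σ (k.natAdd n).castSucc) : ℤ)) := by
  rw [oddDet_apply, Matrix.det_apply, map_sum]
  refine Finset.sum_congr rfl fun σ _ => ?_
  have h1 : ∏ i, Matrix.of (fun j => vecPow (l j)) (σ i) i =
      expo (∑ i, ((l (σ i) : ℤ) : ℚ) • vecWt n i) := by
    rw [expo_sum]
    rfl
  have h2 : oddTerm n (∏ i, Matrix.of (fun j => vecPow (l j)) (σ i) i) =
      ∏ k : Fin n, oddPos ((l (σ (k.castAdd n).castSucc) - l (σ (k.natAdd n).castSucc) : ℤ)) := by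
    rw [h1, oddTerm_expo]
    refine Finset.prod_congr rfl fun k _ => ?_
    rw [Fin.sum_univ_castSucc, Fin.sum_univ_add]
    simp only [vecWt_castAdd, vecWt_natAdd, vecWt_last]
    simp [Finset.sum_apply, Pi.single_apply, sub_eq_add_neg, -Fin.natAdd_eq_addNat]
  rw [← h2]
  rcases Int.units_eq_one_or (Equiv.Perm.sign σ) with h | h <;> simp [h]

/-- An odd difference is nonzero, so its sign can be read off from the order of the indices. This is
why only parities matter. -/
lemma oddPos_sub_of_antitone {N : ℕ} {l : Fin N → ℤ} (hl : Antitone l) (a b : Fin N) :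
    oddPos ((l a - l b : ℤ)) = if a < b ∧ Odd (l a - l b) then 1 else 0 := by
  rw [oddPos_intCast]
  refine if_congr ⟨fun ⟨h1, h2⟩ => ⟨?_, h2⟩, fun ⟨h1, h2⟩ => ⟨?_, h2⟩⟩ rfl rfl
  · by_contra h
    have := hl (not_lt.1 h)
    omega
  · have := hl h1.le
    rw [Int.odd_iff] at h2
    omega

/-- Two neighbouring exponents of the same parity make the determinant vanish. -/
lemma oddDet_vecPow_eq_zero {l : Fin (n + n + 1) → ℤ} (hl : Antitone l) {i j : Fin (n + n + 1)}
    (hij : (j : ℕ) = i + 1) (h : Even (l i - l j)) : oddDet n (fun j => vecPow (l j)) = 0 := by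
  have hne : i ≠ j := fun h => by rw [h] at hij; omega
  -- Exchanging the neighbours i and j alters the order of no pair except {i, j}, whose even
  -- difference contributes zero in both orders. The swap thus preserves every product and only
  -- reverses the sign.
  have key : ∀ a b, oddPos ((l (Equiv.swap i j a) - l (Equiv.swap i j b) : ℤ)) =
      oddPos ((l a - l b : ℤ)) := fun a b => by
    rw [oddPos_sub_of_antitone hl, oddPos_sub_of_antitone hl]
    have hpar : ∀ c, Even (l (Equiv.swap i j c) - l c) := fun c => by
      rcases eq_or_ne c i with rfl | h1
      · rw [Equiv.swap_apply_left, ← neg_sub]; exact h.neg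
      · rcases eq_or_ne c j with rfl | h2
        · rw [Equiv.swap_apply_right]; exact h
        · rw [Equiv.swap_apply_of_ne_of_ne h1 h2, sub_self]; exact Even.zero
    have hodd : Odd (l (Equiv.swap i j a) - l (Equiv.swap i j b)) ↔ Odd (l a - l b) := by
      have h1 := hpar a
      have h2 := hpar b
      rw [Int.even_iff] at h1 h2
      rw [Int.odd_iff, Int.odd_iff]
      omega
    simp only [hodd]
    refine if_congr (and_congr_left fun hab => ?_) rfl rfl
    have hab' : ¬ ((a = i ∧ b = j) ∨ (a = j ∧ b = i)) := by
      rintro (⟨rfl, rfl⟩ | ⟨rfl, rfl⟩)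
      · exact (Int.not_odd_iff_even.2 h) hab
      · rw [← neg_sub, odd_neg] at hab
        exact (Int.not_odd_iff_even.2 h) hab
    have hval : ∀ c, ((Equiv.swap i j c : Fin (n + n + 1)) : ℕ) =
        if c = i then (j : ℕ) else if c = j then (i : ℕ) else c := fun c => by
      rw [Equiv.swap_apply_def]
      split_ifs <;> rfl
    rw [Fin.lt_def, Fin.lt_def, hval, hval]
    simp only [Fin.ext_iff] at hab' ⊢
    split_ifs <;> omega
  have h1 : oddDet n (fun j => vecPow (l j)) = -oddDet n (fun j => vecPow (l j)) := by
    rw [oddDet_vecPow]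
    nth_rewrite 1 [← Equiv.sum_comp (Equiv.mulLeft (Equiv.swap i j))]
    rw [← Finset.sum_neg_distrib]
    refine Finset.sum_congr rfl fun σ _ => ?_
    simp only [Equiv.coe_mulLeft, Equiv.Perm.sign_mul, Equiv.Perm.sign_swap hne,
      Equiv.Perm.mul_apply, key]
    simp
  linear_combination h1 / 2

/-- The determinant only depends on the parities of the exponents. -/
lemma oddDet_vecPow_eq_of_alternating {l : Fin (n + n + 1) → ℤ} (hl : Antitone l)
    (h : ∀ i j, Odd (l i + (i : ℕ)) ↔ Odd (l j + (j : ℕ))) :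
    oddDet n (fun j => vecPow (l j)) = oddDet n (fun j => vecPow (-((j : ℕ) : ℤ))) := by
  have key : ∀ a b : Fin (n + n + 1), oddPos ((l a - l b : ℤ)) =
      oddPos ((-((a : ℕ) : ℤ) - -((b : ℕ) : ℤ) : ℤ)) := fun a b => by
    have hm : Antitone fun j : Fin (n + n + 1) => -((j : ℕ) : ℤ) := fun i j hij => by
      have : (i : ℕ) ≤ j := hij
      simp only
      omega
    rw [oddPos_sub_of_antitone hl, oddPos_sub_of_antitone hm]
    have := h a b
    simp only [Int.odd_iff] at this ⊢
    refine if_congr (and_congr_right fun _ => ?_) rfl rfl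
    omega
  rw [oddDet_vecPow, oddDet_vecPow]
  simp only [key]

lemma alternating_of_adjacent {N : ℕ} {l : Fin (N + 1) → ℤ}
    (h : ∀ i j : Fin (N + 1), (j : ℕ) = i + 1 → Odd (l i - l j)) (i j : Fin (N + 1)) :
    Odd (l i + (i : ℕ)) ↔ Odd (l j + (j : ℕ)) := by
  suffices H : ∀ i : Fin (N + 1), Odd (l i + (i : ℕ)) ↔ Odd (l 0) by rw [H i, H j]
  intro i
  induction i using Fin.induction with
  | zero => simp
  | succ i ih =>
    rw [← ih]
    have := h i.castSucc i.succ (by simp)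
    simp only [Int.odd_iff, Fin.val_succ, Fin.val_castSucc] at this ⊢
    omega

/-- The value of the determinant of the vectors `(1 + z y) y^{D_j}`. -/
lemma oddDet_strictAnti (z : ℂ) {D : Fin (n + n + 1) → ℤ} (hD : StrictAnti D) :
    oddDet n (fun j => vecPow (D j) + z • vecPow (D j + 1)) =
      oddDet n (fun j => vecPow (-((j : ℕ) : ℤ))) *
        (z ^ (Finset.univ.filter fun j => Odd (D j + (j : ℕ))).card +
          z ^ (n + n + 1 - (Finset.univ.filter fun j => Odd (D j + (j : ℕ))).card)) := by
  classical
  set T := Finset.univ.filter fun j => Odd (D j + (j : ℕ)) with hT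
  set c := oddDet n (fun j => vecPow (-((j : ℕ) : ℤ))) with hc
  have h1 : oddDet n (fun j => vecPow (D j) + z • vecPow (D j + 1)) =
      ∑ s : Finset (Fin (n + n + 1)), z ^ s.card *
        oddDet n (fun j => vecPow (D j + if j ∈ s then 1 else 0)) := by
    have h := (oddDet n).toMultilinearMap.map_add_univ (fun j => z • vecPow (D j + 1))
      (fun j => vecPow (D j))
    simp only [AlternatingMap.coe_multilinearMap] at h
    rw [show (fun j => vecPow (D j) + z • vecPow (D j + 1)) =
      (fun j => z • vecPow (n := n) (D j + 1)) + (fun j => vecPow (D j)) from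
        funext fun j => add_comm _ _, h]
    refine Finset.sum_congr rfl fun s _ => ?_
    have h2 := (oddDet n).toMultilinearMap.map_piecewise_smul (fun _ => z)
      (fun j => vecPow (D j + if j ∈ s then 1 else 0)) s
    simp only [AlternatingMap.coe_multilinearMap, Finset.prod_const, smul_eq_mul] at h2
    rw [← h2]
    congr 1
    ext1 j
    by_cases hj : j ∈ s <;> simp [hj]
  -- As D drops by at least 1, raising entries by 0 or 1 keeps it weakly decreasing. The determinant
  -- survives only if all l_j + j have the same parity: even forces s = T, odd forces s = Tᶜ.
  have h2 : ∀ s : Finset (Fin (n + n + 1)),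
      oddDet n (fun j => vecPow (D j + if j ∈ s then 1 else 0)) =
        (if s = T then c else 0) + if s = Tᶜ then c else 0 := by
    intro s
    set l : Fin (n + n + 1) → ℤ := fun j => D j + if j ∈ s then 1 else 0 with hl
    have hanti : Antitone l := fun i j hij => by
      rcases eq_or_lt_of_le hij with rfl | hlt
      · exact le_rfl
      · have := hD hlt
        simp only [hl]
        split_ifs <;> omega
    have hTT : T ≠ Tᶜ := fun h => by
      have h0 : (0 : Fin (n + n + 1)) ∈ T ↔ (0 : Fin (n + n + 1)) ∈ Tᶜ := by rw [← h]
      rw [Finset.mem_compl] at h0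
      tauto
    have hmem : ∀ j, j ∈ T ↔ Odd (D j + (j : ℕ)) := fun j => by simp [hT]
    by_cases hs : s = T
    · rw [if_pos hs, if_neg (fun h => hTT (hs.symm.trans h)), add_zero]
      refine oddDet_vecPow_eq_of_alternating hanti fun i j => ?_
      have key : ∀ i, ¬ Odd (l i + (i : ℕ)) := fun i => by
        have h1 := hmem i
        simp only [hl, hs]
        rw [Int.odd_iff] at h1 ⊢
        split_ifs with h2
        · have := h1.1 h2; omega
        · have := mt h1.2 h2; omega
      exact iff_of_false (key i) (key j)
    · rw [if_neg hs, zero_add]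
      by_cases hs' : s = Tᶜ
      · rw [if_pos hs']
        refine oddDet_vecPow_eq_of_alternating hanti fun i j => ?_
        have key : ∀ i, Odd (l i + (i : ℕ)) := fun i => by
          have h1 := hmem i
          simp only [hl, hs', Finset.mem_compl]
          rw [Int.odd_iff] at h1 ⊢
          split_ifs with h2
          · have := h1.1 h2; omega
          · have := mt h1.2 h2; omega
        exact iff_of_true (key i) (key j)
      · rw [if_neg hs']
        by_contra hne
        have halt : ∀ i j : Fin (n + n + 1), (j : ℕ) = i + 1 → Odd (l i - l j) :=
          fun i j hij => by
            rw [← Int.not_even_iff_odd]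
            exact fun h => hne (oddDet_vecPow_eq_zero hanti hij h)
        have hall := alternating_of_adjacent halt
        by_cases h0 : Odd (l 0 + ((0 : Fin (n + n + 1)) : ℕ))
        · refine hs' (Finset.ext fun i => ?_)
          have h1 := (hall i 0).2 h0
          rw [Finset.mem_compl, hmem]
          simp only [hl, Int.odd_iff] at h1 ⊢
          split_ifs at h1 with h2 <;> simp only [h2, true_iff, false_iff] <;> omega
        · refine hs (Finset.ext fun i => ?_)
          have h1 := mt (hall i 0).1 h0
          rw [hmem]
          simp only [hl, Int.odd_iff] at h1 ⊢
          split_ifs at h1 with h2 <;> simp only [h2, true_iff, false_iff] <;> omega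
  have hcard : Tᶜ.card = n + n + 1 - T.card := by
    rw [Finset.card_compl, Fintype.card_fin]
  rw [h1, Finset.sum_congr rfl fun s _ => by rw [h2 s, mul_add, mul_ite, mul_ite, mul_zero],
    Finset.sum_add_distrib, Finset.sum_ite_eq', Finset.sum_ite_eq']
  simp only [Finset.mem_univ, if_true, hcard]
  ring

lemma card_filter_odd_eq_oddRows : ∀ D : List ℤ,
    (Finset.univ.filter fun j : Fin D.length => Odd (D.getD j 0 + ((j : ℕ) : ℤ))).card = oddRows D
  | [] => rfl
  | d :: D => by
    rw [oddRows, ← card_filter_odd_eq_oddRows D]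
    have h := Fin.card_filter_univ_succ (n := D.length)
      (fun j : Fin (D.length + 1) => Odd ((d :: D).getD j 0 + ((j : ℕ) : ℤ)))
    refine h.trans ?_
    have h2 : (Finset.univ.filter fun j : Fin D.length =>
        Odd ((d :: D).getD j.succ 0 + ((j.succ : ℕ) : ℤ))) =
        (Finset.univ.filter fun j : Fin D.length => Odd (D.getD j 0 + ((j : ℕ) : ℤ)))ᶜ := by
      ext j
      simp only [Finset.mem_filter, Finset.mem_univ, true_and, Finset.mem_compl, Fin.val_succ,
        List.getD_cons_succ, Int.odd_iff]
      push_cast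
      omega
    have h3 : (Finset.univ.filter fun j : Fin D.length =>
        Odd (D.getD j 0 + ((j : ℕ) : ℤ)))ᶜ.card = _ := Finset.card_compl _
    rw [Fintype.card_fin] at h3
    rw [h2, h3]
    simp
    split_ifs <;> omega

/-- The value of the determinant of two-term vectors. -/
lemma oddDet_twoTerm (q z : ℂ) :
    oddDet n (fun j => twoTerm q (fun d => vecPow d + z • vecPow (d + 1)) j) =
      oddDet n (fun j => vecPow (-((j : ℕ) : ℤ))) *
        ((signedLists q (n + n)).map fun p =>
          p.1 * (z ^ oddRows p.2 + z ^ (n + n + 1 - oddRows p.2))).sum := by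
  rw [alternatingMap_twoTerm, ← List.sum_map_mul_left]
  refine congrArg List.sum (List.map_congr_left fun p hp => ?_)
  obtain ⟨h1, -⟩ := signedLists_bounds q (n + n) p hp
  have h2 := length_of_mem_signedLists q (n + n) p hp
  have h3 : StrictAnti fun j : Fin (n + n + 1) => p.2.getD j 0 := fun i j hij => by
    have hi : (i : ℕ) < p.2.length := by omega
    have hj : (j : ℕ) < p.2.length := by omega
    simp only [List.getD_eq_getElem _ _ hi, List.getD_eq_getElem _ _ hj]
    exact List.pairwise_iff_getElem.1 h1 i j hi hj hij
  have h4 := card_filter_odd_eq_oddRows p.2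
  rw [h2] at h4
  rw [oddDet_strictAnti z h3, h4]
  ring

/-! ### Evaluation of the determinant -/

/-- The polynomials with `p_k(y⁻¹ - q y) = y^{-k} + (-q)^k y^k` for `k > 0`, and `p_0 = 1`. -/
def twoTermPoly {R : Type*} [CommRing R] (q : R) : ℕ → R[X]
  | 0 => 1
  | 1 => Polynomial.X
  | 2 => Polynomial.X * Polynomial.X + Polynomial.C (2 * q)
  | k + 3 => Polynomial.X * twoTermPoly q (k + 2) + Polynomial.C q * twoTermPoly q (k + 1)

lemma isMonicOfDegree_twoTermPoly {R : Type*} [CommRing R] [Nontrivial R] (q : R) :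
    ∀ k : ℕ, (twoTermPoly q k).IsMonicOfDegree k
  | 0 => by simp [twoTermPoly]
  | 1 => Polynomial.isMonicOfDegree_X R
  | 2 => by
    have := isMonicOfDegree_recursion (s := 0) (c := 2 * q) (isMonicOfDegree_twoTermPoly q 1)
      (isMonicOfDegree_twoTermPoly q 0)
    simpa [twoTermPoly] using this
  | k + 3 => by
    have := isMonicOfDegree_recursion (s := 0) (c := q) (isMonicOfDegree_twoTermPoly q (k + 2))
      (isMonicOfDegree_twoTermPoly q (k + 1))
    simpa [twoTermPoly] using this

/-- Power sums of w and -q y, whose sum is the argument and whose product is -q. The value at k = 0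
is 1 instead of the power sum 2, to keep the polynomial monic; hence the separate constant 2q at k =
2. -/
lemma eval_twoTermPoly {R : Type*} [CommRing R] (q : R) {y w : R} (h : y * w = 1) : ∀ k : ℕ,
    (twoTermPoly q k).eval (w - q * y) = if k = 0 then 1 else w ^ k + (-q) ^ k * y ^ k
  | 0 => by simp [twoTermPoly]
  | 1 => by simp [twoTermPoly]; ring
  | 2 => by
    simp [twoTermPoly]
    linear_combination (-2 * q) * h
  | k + 3 => by
    have h1 := eval_twoTermPoly q h (k + 2)
    have h2 := eval_twoTermPoly q h (k + 1)
    rw [if_neg (by omega)] at h1 h2 ⊢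
    simp only [twoTermPoly, Polynomial.eval_add, Polynomial.eval_mul, Polynomial.eval_X,
      Polynomial.eval_C]
    rw [h1, h2]
    linear_combination ((-q) ^ (k + 2) * y ^ (k + 1) - q * w ^ (k + 1)) * h

lemma vecPow_mul_neg (i : Fin (n + n + 1)) : vecPow 1 i * vecPow (-1) i = 1 := by
  rw [← vecPow_add, add_neg_cancel, vecPow_zero]

lemma vecPow_natCast (k : ℕ) (i : Fin (n + n + 1)) : vecPow k i = vecPow 1 i ^ k := by
  induction k with
  | zero => rw [Nat.cast_zero, vecPow_zero, pow_zero]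
  | succ k ih => rw [Nat.cast_succ, vecPow_add, ih, pow_succ]

lemma vecPow_neg_natCast (k : ℕ) (i : Fin (n + n + 1)) : vecPow (-k) i = vecPow (-1) i ^ k := by
  induction k with
  | zero => rw [Nat.cast_zero, neg_zero, vecPow_zero, pow_zero]
  | succ k ih => rw [Nat.cast_succ, neg_add, vecPow_add, ih, pow_succ]

/-- The character of the exterior algebra of the adjoint representation, graded by `q`. -/
def adjointProd (n : ℕ) (q : ℂ) : GroupAlg n :=
  pairProd fun i j : Fin (n + n + 1) => 1 + q • (vecPow 1 i * vecPow 1 j)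

/-- The weights of the vector representation sum to zero, and each lies in equally many pairs. -/
lemma pairProd_vecPow_neg :
    (pairProd fun i j : Fin (n + n + 1) => vecPow (n := n) (-1) i * vecPow (-1) j) = 1 := by
  rw [pairProd_double]
  have h1 : ∀ i : Fin n, halfNeg i ^ 2 * halfPos i ^ 2 = 1 := fun i => by
    rw [mul_comm, halfPos_sq_mul_halfNeg_sq]
  simp only [vecPow_neg_one_castAdd, vecPow_neg_one_natAdd, vecPow_last, mul_one, h1,
    Finset.prod_const_one, one_mul]
  refine Finset.prod_eq_one fun i _ => Finset.prod_eq_one fun j _ => ?_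
  split_ifs
  · calc _ = (halfNeg i ^ 2 * halfPos i ^ 2) ^ 2 * (halfNeg j ^ 2 * halfPos j ^ 2) ^ 2 := by ring
      _ = 1 := by rw [h1, h1, one_pow, one_mul]
  · rfl

/-- Each column has the factor 1 + z y; the rest is a Vandermonde determinant in y⁻¹ - q y, where
(b⁻¹ - q b) - (a⁻¹ - q a) = (a - b)(1 + q a b) / (a b) and the denominators multiply to 1. -/
lemma det_twoTerm (q z : ℂ) :
    (Matrix.of fun j : Fin (n + n + 1) =>
      twoTerm q (fun d => vecPow (n := n) d + z • vecPow (d + 1)) j).det =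
    (∏ i, (1 + z • vecPow (n := n) 1 i)) *
      ((pairProd fun i j : Fin (n + n + 1) => vecPow (n := n) 1 i - vecPow 1 j) *
        adjointProd n q) := by
  set Q : GroupAlg n := algebraMap ℂ _ q with hQ
  have h1 : (Matrix.of fun j : Fin (n + n + 1) =>
      twoTerm q (fun d => vecPow (n := n) d + z • vecPow (d + 1)) j) =
      (Matrix.of fun j i : Fin (n + n + 1) => (1 + z • vecPow (n := n) 1 i) *
        (Matrix.of fun i j : Fin (n + n + 1) =>
          (twoTermPoly Q j).eval (vecPow (-1) i - Q * vecPow 1 i)).transpose j i) := by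
    ext1 j i
    simp only [Matrix.of_apply, Matrix.transpose_apply]
    rw [eval_twoTermPoly Q (vecPow_mul_neg i), twoTerm]
    split_ifs with h
    · simp [vecPow_zero]
    · simp only [Pi.add_apply, Pi.smul_apply, vecPow_add, vecPow_natCast, vecPow_neg_natCast]
      simp only [Algebra.smul_def, map_pow, map_neg, ← hQ]
      ring
  rw [h1, Matrix.det_mul_row, Matrix.det_transpose,
    det_eval_of_isMonicOfDegree _ _ (isMonicOfDegree_twoTermPoly Q), adjointProd, ← pairProd_mul]
  congr 1
  have h2 : ∀ i j : Fin (n + n + 1), i < j →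
      vecPow (-1) j - Q * vecPow 1 j - (vecPow (-1) i - Q * vecPow 1 i) =
      ((vecPow 1 i - vecPow 1 j) * (1 + q • (vecPow 1 i * vecPow 1 j))) *
        (vecPow (-1) i * vecPow (-1) j) := fun i j _ => by
    have hi := vecPow_mul_neg i
    have hj := vecPow_mul_neg j
    rw [Algebra.smul_def, ← hQ]
    generalize vecPow 1 i = a at *
    generalize vecPow (-1) i = a' at *
    generalize vecPow 1 j = b at *
    generalize vecPow (-1) j = b' at *
    linear_combination (-b' - Q * (a - b) * (b * b')) * hi + (a' - Q * (a - b)) * hj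
  rw [pairProd_congr h2, pairProd_mul _ fun i j => vecPow (-1) i * vecPow (-1) j,
    pairProd_vecPow_neg, mul_one]

/-- A sign. -/
def vecSign (n : ℕ) : ℂ := (-1) ^ n * pairProd fun _ _ : Fin n => -1

/-- The pairs among x_i, x_i⁻¹, 1 give -(x_i - x_i⁻¹)(x_i^{1/2} - x_i^{-1/2})², and the four mixed
pairs for i < j give -(x_i + x_i⁻¹ - x_j - x_j⁻¹)². One factor x_i - x_i⁻¹ per index is left over
beyond a_ρ², which is what `oddTerm` divides out. -/
lemma prod_vec_sub :
    (pairProd fun i j : Fin (n + n + 1) => vecPow (n := n) 1 i - vecPow 1 j) =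
      vecSign n • (alternant (rho n) * alternant (rho n) *
        ∏ i : Fin n, (halfPos i ^ 2 - halfNeg i ^ 2)) := by
  have h2 : alternant (rho n) * alternant (rho n) =
      (∏ i : Fin n, (halfPos i - halfNeg i) ^ 2) *
        pairProd fun i j : Fin n => (xSum j - xSum i) * (xSum j - xSum i) := by
    rw [alternant_rho, smul_mul_smul_comm, revSign_mul_self, one_smul, pairProd_mul,
      Finset.prod_pow]
    ring
  have h3 : algebraMap ℂ (GroupAlg n) (vecSign n) =
      (∏ _i : Fin n, (-1)) * pairProd fun _ _ : Fin n => (-1) := by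
    generalize algebraMap ℂ (GroupAlg n) = A
    simp [vecSign, pairProd, apply_ite A]
  rw [pairProd_double, h2, Algebra.smul_def, h3]
  simp only [vecPow_one_castAdd, vecPow_one_natAdd, vecPow_last]
  have e1 : (∏ i : Fin n, (halfPos i ^ 2 - halfNeg i ^ 2) *
      ((halfPos i ^ 2 - 1) * (halfNeg i ^ 2 - 1))) =
      (∏ _i : Fin n, (-1)) * (∏ i : Fin n, (halfPos i - halfNeg i) ^ 2) *
        ∏ i : Fin n, (halfPos i ^ 2 - halfNeg i ^ 2) := by
    rw [← Finset.prod_mul_distrib, ← Finset.prod_mul_distrib]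
    refine Finset.prod_congr rfl fun i _ => ?_
    have hi := halfPos_mul_halfNeg i
    generalize halfPos i = a at *
    generalize halfNeg i = b at *
    linear_combination (a ^ 2 - b ^ 2) * (a * b - 1) * hi
  have e2 : (pairProd fun i j : Fin n => (halfPos i ^ 2 - halfPos j ^ 2) *
      (halfNeg i ^ 2 - halfNeg j ^ 2) *
        ((halfPos i ^ 2 - halfNeg j ^ 2) * (halfPos j ^ 2 - halfNeg i ^ 2))) =
      (pairProd fun _ _ : Fin n => (-1)) *
        pairProd fun i j : Fin n => (xSum j - xSum i) * (xSum j - xSum i) := by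
    rw [← pairProd_mul]
    refine pairProd_congr fun i j _ => ?_
    have hi := halfPos_sq_mul_halfNeg_sq i
    have hj := halfPos_sq_mul_halfNeg_sq j
    simp only [xSum]
    generalize halfPos i ^ 2 = a at *
    generalize halfNeg i ^ 2 = a' at *
    generalize halfPos j ^ 2 = b at *
    generalize halfNeg j ^ 2 = b' at *
    have e1 : (a - b) * (a - b') = a * (a + a' - (b + b')) := by
      linear_combination hj - hi
    have e2 : (a' - b') * (b - a') = -(a' * (a + a' - (b + b'))) := by
      linear_combination hi - hj
    calc (a - b) * (a' - b') * ((a - b') * (b - a')) =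
        ((a - b) * (a - b')) * ((a' - b') * (b - a')) := by ring
      _ = _ := by
        rw [e1, e2]
        linear_combination (-(a + a' - (b + b')) ^ 2) * hi
  rw [e1, e2]
  generalize (∏ _i : Fin n, (-1 : GroupAlg n)) = t1
  generalize (pairProd fun _ _ : Fin n => (-1 : GroupAlg n)) = t2
  generalize (∏ i : Fin n, (halfPos i - halfNeg i) ^ 2) = t3
  ring

lemma vecSign_ne_zero (n : ℕ) : vecSign n ≠ 0 := by
  refine mul_ne_zero (pow_ne_zero _ (by norm_num)) (Finset.prod_ne_zero_iff.2 fun i _ =>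
    Finset.prod_ne_zero_iff.2 fun j _ => ?_)
  split_ifs <;> norm_num

lemma oddDet_twoTerm_eq_coeff (q z : ℂ) :
    oddDet n (fun j => twoTerm q (fun d => vecPow d + z • vecPow (d + 1)) j) =
      vecSign n * (adjointProd n q * alternant (rho n) *
        (alternant (rho n) * ∏ i, (1 + z • vecPow (n := n) 1 i))).coeff 0 := by
  rw [oddDet_apply, det_twoTerm, prod_vec_sub, ← oddTerm_mul_prod, ← smul_eq_mul (vecSign n),
    ← map_smul (oddTerm n) (vecSign n)]
  congr 1
  simp only [Algebra.smul_def]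
  ring

lemma adjointProd_zero : adjointProd n 0 = 1 := by
  simp [adjointProd, pairProd]

/-- The normalising constant is read off at q = z = 0, where the pairing is that of a_ρ with itself.
It is nonzero, so it can later be cancelled. -/
lemma oddDet_neg : oddDet n (fun j => vecPow (-((j : ℕ) : ℤ))) =
    vecSign n * ((-1) ^ n * Fintype.card (SignedPerm n)) := by
  classical
  have h := oddDet_twoTerm_eq_coeff (n := n) 0 0
  have h1 : ∀ j : Fin (n + n + 1), twoTerm 0 (fun d => vecPow (n := n) d + (0 : ℂ) • vecPow (d + 1)) j =
      vecPow (-((j : ℕ) : ℤ)) := fun j => by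
    rw [twoTerm]
    split_ifs with hj
    · simp [hj]
    · simp [zero_pow hj]
  simp only [h1] at h
  have h2 := (isAntisymm_alternant (rho n)).coeff_mul_alternant (rho n)
  have h3 := coeff_alternant_of_strictAnti (rho_strictAnti (n := n)) rho_strictAnti
    (rho_pos (n := n)) rho_pos
  rw [h, adjointProd_zero]
  simp only [zero_smul, add_zero, Finset.prod_const_one, mul_one, one_mul, h2, h3]
  simp

lemma prod_vec_one_add (z : ℂ) : ∏ i, (1 + z • vecPow (n := n) 1 i) =
    (1 + z) • ∏ i : Fin n, (1 + z • halfPos i ^ 2) * (1 + z • halfNeg i ^ 2) := by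
  rw [Fin.prod_univ_castSucc, Fin.prod_univ_add, Finset.prod_mul_distrib]
  simp only [vecPow_one_castAdd, vecPow_one_natAdd, vecPow_last, Algebra.smul_def, map_add, map_one]
  ring

/-- The multiplicity generating function. -/
lemma sum_coeff_adjointProd (q : ℂ) {z : ℂ} (hz : z ≠ 0)
    (hf : ∀ w, actHom w (adjointProd n q) = adjointProd n q) :
    ∑ k : Fin (n + 1), (z ^ (n - k : ℕ) + z ^ (n + k + 1 : ℕ)) *
      (adjointProd n q * alternant (rho n)).coeff ((omegaWeight n (n - k)).1 + rho n) =
    ((signedLists q (n + n)).map fun p =>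
      p.1 * (z ^ oddRows p.2 + z ^ (n + n + 1 - oddRows p.2))).sum := by
  have h1 := oddDet_twoTerm_eq_coeff (n := n) q z
  rw [oddDet_twoTerm, oddDet_neg, prod_vec_one_add, alternant_rho_mul_prod hz, Finset.mul_sum,
    ← coeffAt_apply, map_sum] at h1
  have hg := IsAntisymm.invariant_mul hf (isAntisymm_alternant (rho n))
  simp only [mul_smul_comm, map_smul, coeffAt_apply, hg.coeff_mul_alternant, smul_eq_mul] at h1
  have hc : vecSign n * ((-1) ^ n * (Fintype.card (SignedPerm n) : ℂ)) ≠ 0 :=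
    mul_ne_zero (vecSign_ne_zero n) (mul_ne_zero (pow_ne_zero _ (by norm_num))
      (Nat.cast_ne_zero.2 Fintype.card_ne_zero))
  refine mul_left_cancel₀ hc (Eq.trans ?_ h1.symm)
  rw [Finset.mul_sum, Finset.mul_sum]
  exact Finset.sum_congr rfl fun k _ => by ring

/-- The multiplicity of the exterior power `Λ^m` of the vector representation. -/
lemma coeff_adjointProd (q : ℂ) (hf : ∀ w, actHom w (adjointProd n q) = adjointProd n q)
    {m : ℕ} (hm : m ≤ n) :
    (adjointProd n q * alternant (rho n)).coeff ((omegaWeight n m).1 + rho n) =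
      rowSum q (n + n) m + rowSum q (n + n) (n + n + 1 - m) := by
  set c : ℕ → ℂ := fun m =>
    (adjointProd n q * alternant (rho n)).coeff ((omegaWeight n m).1 + rho n) with hc
  set P : ℂ[X] := ∑ k : Fin (n + 1), (Polynomial.X ^ (n - k : ℕ) + Polynomial.X ^ (n + k + 1 : ℕ)) *
    Polynomial.C (c (n - k)) with hP
  set Q : ℂ[X] := ((signedLists q (n + n)).map fun p => Polynomial.C p.1 *
    (Polynomial.X ^ oddRows p.2 + Polynomial.X ^ (n + n + 1 - oddRows p.2))).sum with hQ
  -- The identity is known for every z ≠ 0, hence as one of polynomials. Since n - k ≤ n < n + k +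
  -- 1, only k = n - m contributes to the coefficient of z^m on the left.
  have hPQ : P = Q := by
    refine Polynomial.eq_of_infinite_eval_eq P Q (Set.Infinite.mono (s := {0}ᶜ) (fun z hz => ?_)
      (Set.Finite.infinite_compl (Set.finite_singleton 0)))
    have h := sum_coeff_adjointProd q (Set.mem_compl_singleton_iff.1 hz) hf
    have e1 : P.eval z = _ := Polynomial.eval_finsetSum _ _ _
    have e2 : Q.eval z = _ := map_list_sum (Polynomial.evalRingHom z) _
    rw [Set.mem_ofPred_eq, e1, e2, List.map_map]
    simpa [Function.comp_def] using h
  have h1 : P.coeff m = c m := by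
    rw [hP, Polynomial.finsetSum_coeff, Finset.sum_eq_single (⟨n - m, by omega⟩ : Fin (n + 1))]
    · simp only [Polynomial.coeff_mul_C, Polynomial.coeff_add, Polynomial.coeff_X_pow]
      rw [Nat.sub_sub_self hm, if_pos rfl, if_neg (by omega), add_zero, one_mul]
    · intro k _ hk
      have hk' : (k : ℕ) ≠ n - m := fun h => hk (Fin.ext h)
      simp only [Polynomial.coeff_mul_C, Polynomial.coeff_add, Polynomial.coeff_X_pow]
      rw [if_neg (by omega), if_neg (by omega), add_zero, zero_mul]
    · simp
  have h2 : Q.coeff m = rowSum q (n + n) m + rowSum q (n + n) (n + n + 1 - m) := by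
    have e : Q.coeff m = _ := map_list_sum (Polynomial.lcoeff ℂ m) _
    rw [e, List.map_map, rowSum, rowSum, ← List.sum_map_add]
    refine congrArg List.sum (List.map_congr_left fun p hp => ?_)
    have h2 := length_of_mem_signedLists q (n + n) p hp
    have h3 := oddRows_le_length p.2
    simp only [Function.comp_apply, Polynomial.lcoeff_apply, Polynomial.coeff_C_mul,
      Polynomial.coeff_add, Polynomial.coeff_X_pow, mul_add]
    congr 1 <;> split_ifs <;> first | omega | simp
  change c m = _
  rw [← h1, hPQ, h2]

/-! ### The roots -/

lemma unit_cast_ne_zero (ε : ℤˣ) : ((ε : ℤ) : ℚ) ≠ 0 := by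
  rcases Int.units_eq_one_or ε with rfl | rfl <;> simp

lemma unit_cast_injective {ε δ : ℤˣ} (h : ((ε : ℤ) : ℚ) = ((δ : ℤ) : ℚ)) : ε = δ :=
  Units.ext (by exact_mod_cast h)

lemma mem_roots {α : Wt n} : α ∈ roots n ↔
    (∃ (i : Fin n) (ε : ℤˣ), α = Pi.single i ((ε : ℤ) : ℚ)) ∨
    ∃ (i j : Fin n) (s t : ℤˣ), i ≠ j ∧
      α = Pi.single i ((s : ℤ) : ℚ) + Pi.single j ((t : ℤ) : ℚ) := by
  simp only [roots, Finset.mem_union, Finset.mem_image, Finset.mem_univ, true_and,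
    Finset.mem_filter, Prod.exists]
  refine or_congr ?_ ?_
  · exact exists_congr fun i => exists_congr fun ε => eq_comm
  · exact exists_congr fun i => exists_congr fun j => exists_congr fun s => exists_congr fun t =>
      and_congr_right fun _ => eq_comm

lemma act_single (w : SignedPerm n) (i : Fin n) (a : ℚ) :
    act w (Pi.single i a) = Pi.single (w.1 i) (((w.2 (w.1 i) : ℤ) : ℚ) * a) := by
  ext k
  simp only [act]
  rcases eq_or_ne k (w.1 i) with rfl | h
  · simp
  · rw [Pi.single_eq_of_ne h, Pi.single_eq_of_ne, mul_zero]
    rintro rfl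
    simp at h

lemma act_mem_roots (w : SignedPerm n) {α : Wt n} (hα : α ∈ roots n) : act w α ∈ roots n := by
  rw [mem_roots] at hα ⊢
  rcases hα with ⟨i, ε, rfl⟩ | ⟨i, j, s, t, hij, rfl⟩
  · exact Or.inl ⟨w.1 i, w.2 (w.1 i) * ε, by rw [act_single]; push_cast; rfl⟩
  · exact Or.inr ⟨w.1 i, w.1 j, w.2 (w.1 i) * s, w.2 (w.1 j) * t, w.1.injective.ne hij, by
      rw [act_add, act_single, act_single]; push_cast; rfl⟩

lemma image_act_roots (w : SignedPerm n) : (roots n).image (act w) = roots n := by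
  refine Finset.eq_of_subset_of_card_le (fun α hα => ?_) ?_
  · obtain ⟨β, hβ, rfl⟩ := Finset.mem_image.1 hα
    exact act_mem_roots w hβ
  · rw [Finset.card_image_of_injective _ (act_injective w)]

lemma prod_roots_act {R : Type*} [CommMonoid R] (w : SignedPerm n) (F : Wt n → R) :
    ∏ α ∈ roots n, F (act w α) = ∏ α ∈ roots n, F α := by
  nth_rewrite 2 [← image_act_roots w]
  rw [Finset.prod_image fun x _ y _ h => act_injective w h]

lemma single_add_single_injective {i j i' j' : Fin n} (hij : i < j) (hij' : i' < j')
    {s t s' t' : ℤˣ} (h : (Pi.single i ((s : ℤ) : ℚ) + Pi.single j ((t : ℤ) : ℚ) : Wt n) =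
      Pi.single i' ((s' : ℤ) : ℚ) + Pi.single j' ((t' : ℤ) : ℚ)) :
    i = i' ∧ j = j' ∧ s = s' ∧ t = t' := by
  have hi := congrFun h i
  have hj := congrFun h j
  have hi' := congrFun h i'
  simp only [Pi.add_apply, Pi.single_apply] at hi hj hi'
  rw [if_pos trivial, if_neg hij.ne, add_zero] at hi
  rw [if_neg hij.ne', if_pos trivial, zero_add] at hj
  rw [if_pos trivial, if_neg hij'.ne, add_zero] at hi'
  have hs := unit_cast_ne_zero s
  have ht := unit_cast_ne_zero t
  have hs' := unit_cast_ne_zero s'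
  have h1 : i = i' := by
    by_contra hne
    rw [if_neg hne, zero_add] at hi
    rw [if_neg (Ne.symm hne), zero_add] at hi'
    split_ifs at hi with h1
    · split_ifs at hi' with h2
      · rw [h1, ← h2] at hij
        exact absurd hij hij'.not_gt
      · exact hs' hi'.symm
    · exact hs hi
  subst h1
  rw [if_pos rfl, if_neg hij'.ne, add_zero] at hi
  rw [if_neg hij.ne', zero_add] at hj
  split_ifs at hj with h2
  · exact ⟨rfl, h2, unit_cast_injective hi, unit_cast_injective hj⟩
  · exact absurd hj ht

lemma prod_roots {R : Type*} [CommMonoid R] (F : Wt n → R) : ∏ α ∈ roots n, F α =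
    (∏ i : Fin n, F (Pi.single i 1) * F (Pi.single i (-1))) *
    pairProd fun i j : Fin n =>
      F (Pi.single i 1 + Pi.single j 1) * F (Pi.single i (-1) + Pi.single j (-1)) *
      (F (Pi.single i 1 + Pi.single j (-1)) * F (Pi.single j 1 + Pi.single i (-1))) := by
  classical
  have hV : ((Finset.univ.filter fun p : (Fin n × Fin n) × (ℤˣ × ℤˣ) => p.1.1 ≠ p.1.2).image
      fun p => (Pi.single p.1.1 ((p.2.1 : ℤ) : ℚ) + Pi.single p.1.2 ((p.2.2 : ℤ) : ℚ) : Wt n)) =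
      ((Finset.univ.filter fun p : (Fin n × Fin n) × (ℤˣ × ℤˣ) => p.1.1 < p.1.2).image
      fun p => (Pi.single p.1.1 ((p.2.1 : ℤ) : ℚ) + Pi.single p.1.2 ((p.2.2 : ℤ) : ℚ) : Wt n)) := by
    ext α
    simp only [Finset.mem_image, Finset.mem_filter, Finset.mem_univ, true_and, Prod.exists]
    constructor
    · rintro ⟨i, j, s, t, hij, rfl⟩
      rcases lt_or_gt_of_ne hij with h | h
      · exact ⟨i, j, s, t, h, rfl⟩
      · exact ⟨j, i, t, s, h, add_comm _ _⟩
    · rintro ⟨i, j, s, t, hij, rfl⟩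
      exact ⟨i, j, s, t, hij.ne, rfl⟩
  have hu : (Finset.univ : Finset ℤˣ) = {1, -1} := rfl
  rw [roots, Finset.prod_union, hV, Finset.prod_image, Finset.prod_image, Fintype.prod_prod_type]
  · congr 1
    · refine Finset.prod_congr rfl fun i _ => ?_
      rw [hu, Finset.prod_pair (by decide)]
      simp
    · rw [Finset.prod_filter, Fintype.prod_prod_type, Fintype.prod_prod_type, pairProd]
      refine Finset.prod_congr rfl fun i _ => Finset.prod_congr rfl fun j _ => ?_
      split_ifs with hij
      · rw [Fintype.prod_prod_type, hu, Finset.prod_pair (by decide), Finset.prod_pair (by decide),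
          Finset.prod_pair (by decide)]
        simp only [Units.val_one, Units.val_neg, Int.cast_one, Int.cast_neg]
        rw [add_comm (Pi.single i (-1) : Wt n) (Pi.single j 1)]
        simp only [mul_left_comm, mul_comm]
      · simp
  · rintro ⟨⟨i, j⟩, s, t⟩ hp ⟨⟨i', j'⟩, s', t'⟩ hp' h
    simp only [Finset.coe_filter, Finset.mem_univ, true_and, Set.mem_ofPred_eq] at hp hp'
    obtain ⟨rfl, rfl, rfl, rfl⟩ := single_add_single_injective hp hp' h
    rfl
  · rintro ⟨i, s⟩ _ ⟨i', s'⟩ _ h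
    have hi := congrFun h i
    simp only [Pi.single_eq_same, Pi.single_apply] at hi
    split_ifs at hi with h1
    · exact Prod.ext h1 (unit_cast_injective hi)
    · exact absurd hi (unit_cast_ne_zero s)
  · rw [Finset.disjoint_left]
    intro α h1 h2
    simp only [Finset.mem_image, Finset.mem_filter, Finset.mem_univ, true_and, Prod.exists] at h1 h2
    obtain ⟨k, r, rfl⟩ := h1
    obtain ⟨i, j, s, t, hij, h⟩ := h2
    have hi := congrFun h i
    have hj := congrFun h j
    simp only [Pi.add_apply, Pi.single_apply] at hi hj
    rw [if_pos trivial, if_neg hij, add_zero] at hi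
    rw [if_neg hij.symm, if_pos trivial, zero_add] at hj
    split_ifs at hi with h1
    · split_ifs at hj with h2
      · exact hij (h1.trans h2.symm)
      · exact unit_cast_ne_zero t hj
    · exact unit_cast_ne_zero s hi

/-- Sums of two distinct weights of the vector representation give every root once and 0 with
multiplicity n, from the pairs e_i, -e_i. -/
lemma adjointProd_eq (q : ℂ) :
    adjointProd n q = (1 + q • expo 0) ^ n * ∏ α ∈ roots n, (1 + q • expo α) := by
  rw [prod_roots, adjointProd, pairProd_double, expo_zero, ← mul_assoc]
  have h1 : ∀ (i : Fin n), halfPos i ^ 2 = expo (Pi.single i 1 : Wt n) := fun i => by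
    rw [halfPos_pow]; norm_num
  have h2 : ∀ (i : Fin n), halfNeg i ^ 2 = expo (Pi.single i (-1) : Wt n) := fun i => by
    rw [halfNeg_pow]; norm_num
  have h3 : ∀ i : Fin n, expo (Pi.single i 1 : Wt n) * expo (Pi.single i (-1)) = 1 := fun i => by
    rw [← h1, ← h2, halfPos_sq_mul_halfNeg_sq]
  simp only [vecPow_one_castAdd, vecPow_one_natAdd, vecPow_last, mul_one, h1, h2, h3, expo_add]
  congr 1
  rw [Finset.prod_mul_distrib, Finset.prod_const, Finset.card_univ, Fintype.card_fin]

lemma adjointProd_invariant (q : ℂ) (w : SignedPerm n) :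
    actHom w (adjointProd n q) = adjointProd n q := by
  have h0 : act w (0 : Wt n) = 0 := (actAdd w).map_zero
  rw [adjointProd_eq, map_mul, map_pow, map_prod]
  simp only [map_add, map_one, map_smul, actHom_expo, h0]
  rw [prod_roots_act w fun α => 1 + q • expo α]

/-! ### Symmetries of the kernel -/

lemma factor_mul (i : ℕ) (μ : Wt n) :
    factor i μ * (1 - MvPowerSeries.X 1 * MvPowerSeries.X 0 ^ i * MvPowerSeries.C (expo μ)) =
      1 - MvPowerSeries.X 0 ^ (i + 1) * MvPowerSeries.C (expo μ) := by
  have h := MvPowerSeries.mul_invOfUnit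
    (1 - MvPowerSeries.X 1 * MvPowerSeries.X 0 ^ i * MvPowerSeries.C (expo μ) :
      QT (GroupAlg n)) 1 (by simp)
  rw [factor]
  linear_combination (1 - MvPowerSeries.X 0 ^ (i + 1) * MvPowerSeries.C (expo μ)) * h

lemma isUnit_denominator (i : ℕ) (μ : Wt n) :
    IsUnit (1 - MvPowerSeries.X 1 * MvPowerSeries.X 0 ^ i * MvPowerSeries.C (expo μ) :
      QT (GroupAlg n)) :=
  IsUnit.of_mul_eq_one _ (MvPowerSeries.mul_invOfUnit _ 1 (by simp))

lemma map_factor (τ : GroupAlg n →+* GroupAlg n) {μ ν : Wt n} (h : τ (expo μ) = expo ν) (i : ℕ) :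
    MvPowerSeries.map τ (factor i μ) = factor i ν := by
  have h1 := congrArg (MvPowerSeries.map τ) (factor_mul i μ)
  simp only [map_mul, map_sub, map_one, map_pow, MvPowerSeries.map_X, MvPowerSeries.map_C, h] at h1
  exact (isUnit_denominator i ν).mul_right_cancel (h1.trans (factor_mul i ν).symm)

/-- Used twice: with g the action of a signed permutation, for Weyl symmetry, and with g the
identity and τ a phase, for integrality of the exponents. -/
lemma map_coeff_kernel (τ : GroupAlg n →+* GroupAlg n)
    (h0 : τ (expo 0) = expo 0) (g : Wt n → Wt n) (hg : ∀ α ∈ roots n, τ (expo α) = expo (g α))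
    (hprod : ∀ F : Wt n → QT (GroupAlg n), ∏ α ∈ roots n, F (g α) = ∏ α ∈ roots n, F α)
    (d : Fin 2 →₀ ℕ) :
    τ (MvPowerSeries.coeff d (macdonaldKernel n)) = MvPowerSeries.coeff d (macdonaldKernel n) := by
  have hl : ∀ i, MvPowerSeries.map τ (layer n i) = layer n i := fun i => by
    rw [layer, map_mul, map_pow, map_prod, map_factor τ h0,
      Finset.prod_congr rfl fun α hα => map_factor τ (hg α hα) i, hprod]
  rw [← coeff_prod_layer n d _ le_rfl, ← MvPowerSeries.coeff_map, map_prod]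
  simp only [hl]

lemma actHom_coeff_kernel (w : SignedPerm n) (d : Fin 2 →₀ ℕ) :
    actHom w (MvPowerSeries.coeff d (macdonaldKernel n)) =
      MvPowerSeries.coeff d (macdonaldKernel n) :=
  map_coeff_kernel (actHom w).toRingHom
    (by rw [expo_zero]; exact map_one _) (act w) (fun α _ => actHom_expo w α) (prod_roots_act w) d

/-- The automorphism `e^μ ↦ exp (2 π i μ_k) e^μ`, which detects integrality. -/
def phase (k : Fin n) : GroupAlg n →ₐ[ℂ] GroupAlg n :=
  AddMonoidAlgebra.lift ℂ (GroupAlg n) (Wt n)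
    { toFun := fun μ => Complex.exp ((μ.toAdd k : ℚ) * (2 * Real.pi * Complex.I)) • expo μ.toAdd
      map_one' := by simp [expo_zero]
      map_mul' := fun μ ν => by
        rw [toAdd_mul, expo_add, smul_mul_smul_comm, ← Complex.exp_add, Pi.add_apply]
        congr 2
        push_cast
        ring }

lemma phase_expo (k : Fin n) (μ : Wt n) :
    phase k (expo μ) = Complex.exp ((μ k : ℚ) * (2 * Real.pi * Complex.I)) • expo μ := by
  simp [phase, expo]

lemma coeff_phase (k : Fin n) (f : GroupAlg n) (κ : Wt n) : (phase k f).coeff κ =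
    Complex.exp ((κ k : ℚ) * (2 * Real.pi * Complex.I)) * f.coeff κ := by
  classical
  have h : coeffAt κ ∘ₗ (phase k).toLinearMap =
      Complex.exp ((κ k : ℚ) * (2 * Real.pi * Complex.I)) • coeffAt κ := linearMap_ext_expo fun μ => by
    simp only [LinearMap.comp_apply, AlgHom.toLinearMap_apply, phase_expo, map_smul,
      LinearMap.smul_apply, coeffAt_apply, coeff_expo]
    split_ifs with h
    · rw [h]
    · simp
  exact LinearMap.congr_fun h f

lemma exp_int (k : ℤ) : Complex.exp (((k : ℤ) : ℂ) * (2 * Real.pi * Complex.I)) = 1 :=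
  Complex.exp_int_mul_two_pi_mul_I k

/-- Weights all of whose coordinates are half-odd. -/
def IsHalfOdd (ν : Wt n) : Prop := ∀ i, ∃ k : ℤ, ν i = k + 1 / 2

lemma phase_expo_of_isHalfOdd {ν : Wt n} (hν : IsHalfOdd ν) (k : Fin n) :
    phase k (expo ν) = -expo ν := by
  obtain ⟨m, hm⟩ := hν k
  have h1 : Complex.exp ((ν k : ℚ) * (2 * Real.pi * Complex.I)) = -1 := by
    rw [hm, ← Complex.exp_pi_mul_I, ← one_mul (Complex.exp (Real.pi * Complex.I)), ← exp_int m,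
      ← Complex.exp_add]
    congr 1
    push_cast
    ring
  rw [phase_expo, h1, neg_one_smul]

lemma IsHalfOdd.act {ν : Wt n} (hν : IsHalfOdd ν) (w : SignedPerm n) : IsHalfOdd (act w ν) :=
  fun i => by
  obtain ⟨m, hm⟩ := hν (w.1.symm i)
  simp only [TypeB.act, hm]
  rcases Int.units_eq_one_or (w.2 i) with h | h
  · exact ⟨m, by simp [h]⟩
  · exact ⟨-m - 1, by rw [h]; push_cast; ring⟩

lemma phase_alternant {ν : Wt n} (hν : IsHalfOdd ν) (k : Fin n) :
    phase k (alternant ν) = -alternant ν := by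
  rw [alternant, map_sum, ← Finset.sum_neg_distrib]
  refine Finset.sum_congr rfl fun w _ => ?_
  rw [map_smul, phase_expo_of_isHalfOdd (hν.act w), smul_neg]

lemma isHalfOdd_of_coeff_ne_zero {g : GroupAlg n} (hg : ∀ k, phase k g = -g) {κ : Wt n}
    (hκ : g.coeff κ ≠ 0) : IsHalfOdd κ := fun k => by
  have h := coeff_phase k g κ
  rw [hg k, AddMonoidAlgebra.coeff_neg, Finsupp.neg_apply] at h
  have h1 : Complex.exp ((κ k : ℚ) * (2 * Real.pi * Complex.I)) = -1 :=
    mul_right_cancel₀ hκ (by rw [← h]; ring)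
  have h2 : Complex.exp ((κ k : ℚ) * (2 * Real.pi * Complex.I) + -(Real.pi * Complex.I)) = 1 := by
    rw [Complex.exp_add, h1, Complex.exp_neg, Complex.exp_pi_mul_I]
    norm_num
  obtain ⟨m, hm⟩ := Complex.exp_eq_one_iff.1 h2
  refine ⟨m, ?_⟩
  have h3 : (2 * Real.pi * Complex.I : ℂ) ≠ 0 := Complex.two_pi_I_ne_zero
  have h4 : (((κ k : ℚ) : ℂ) - (m + 1 / 2)) * (2 * Real.pi * Complex.I) = 0 := by
    linear_combination hm
  have h5 : ((κ k : ℚ) : ℂ) = ((m + 1 / 2 : ℚ) : ℂ) := by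
    push_cast
    exact sub_eq_zero.1 ((mul_eq_zero.1 h4).resolve_right h3)
  exact_mod_cast h5

lemma phase_coeff_kernel (k : Fin n) (d : Fin 2 →₀ ℕ) :
    phase k (MvPowerSeries.coeff d (macdonaldKernel n)) =
      MvPowerSeries.coeff d (macdonaldKernel n) := by
  refine map_coeff_kernel (phase k).toRingHom (by rw [expo_zero]; exact map_one _) id
    (fun α hα => ?_) (fun F => rfl) d
  have h : ∃ m : ℤ, α k = m := by
    rcases mem_roots.1 hα with ⟨i, ε, rfl⟩ | ⟨i, j, s, t, hij, rfl⟩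
    · exact ⟨(Pi.single i (ε : ℤ) : Fin n → ℤ) k, by simp only [Pi.single_apply]; push_cast; rfl⟩
    · exact ⟨(Pi.single i (s : ℤ) + Pi.single j (t : ℤ) : Fin n → ℤ) k, by
        simp only [Pi.add_apply, Pi.single_apply]; push_cast; rfl⟩
  obtain ⟨m, hm⟩ := h
  refine (phase_expo k α).trans ?_
  rw [hm, Rat.cast_intCast, exp_int, one_smul]
  rfl

/-! ### Expansion in irreducible characters -/

lemma isHalfOdd_rho : IsHalfOdd (rho n) := fun i => ⟨n - (i + 1), by
  rw [rho]; push_cast; ring⟩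

/-- Half-odd strictly dominant weights are translates of dominant weights by `ρ`. -/
lemma isDominant_sub_rho {ν : Wt n} (hν : IsHalfOdd ν) (hanti : StrictAnti ν)
    (h0 : ∀ i, 0 ≤ ν i) : IsDominant (ν - rho n) := by
  choose k hk using hν
  have hk' : ∀ i j, i < j → k j + 1 ≤ k i := fun i j hij => by
    have h := hanti hij
    rw [hk, hk] at h
    have h2 : (k j : ℚ) < k i := by linarith
    exact_mod_cast h2
  have hd : ∀ d : ℕ, ∀ i j : Fin n, (j : ℕ) = i + d → k j + d ≤ k i := by
    intro d
    induction d with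
    | zero =>
      intro i j h
      rw [Fin.ext (h.trans (add_zero _))]
      simp
    | succ d ih =>
      intro i j h
      have h1 := ih i ⟨i + d, by omega⟩ rfl
      have h2 := hk' ⟨i + d, by omega⟩ j (by rw [Fin.lt_def]; simp only; omega)
      push_cast
      omega
  have hk0 : ∀ i, 0 ≤ k i := fun i => by
    have h := h0 i
    rw [hk] at h
    by_contra hneg
    have : (k i : ℚ) ≤ -1 := by exact_mod_cast (by omega : k i ≤ -1)
    linarith
  have hval : ∀ i, (ν - rho n) i = ((k i - (n - (i + 1)) : ℤ) : ℚ) := fun i => by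
    rw [Pi.sub_apply, hk, rho]; push_cast; ring
  refine ⟨Or.inl fun i => ⟨_, hval i⟩, fun i j hij => ?_, fun i => ?_⟩
  · rw [hval, hval, Int.cast_le]
    have hij' : (i : ℕ) ≤ j := hij
    have := hd (j - i) i j (by omega)
    omega
  · rw [hval]
    have hn := i.2
    have := hd (n - 1 - i) i ⟨n - 1, by omega⟩ (by simp only; omega)
    have := hk0 ⟨n - 1, by omega⟩
    exact_mod_cast (by omega : (0 : ℤ) ≤ k i - (n - (i + 1)))

/-- A weight in the support can be moved to a decreasing nonnegative one. Its coordinates are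
distinct, since a transposition fixing it would kill the coefficient, and half-odd by the phase
condition; so it has the form μ + ρ. -/
lemma IsAntisymm.eq_zero {g : GroupAlg n} (hg : IsAntisymm g) (hh : ∀ k, phase k g = -g)
    (h : ∀ μ : DominantWeight n, g.coeff (μ.1 + rho n) = 0) : g = 0 := by
  refine AddMonoidAlgebra.coeff_injective (Finsupp.ext fun κ => ?_)
  change g.coeff κ = 0
  by_contra hκ
  obtain ⟨w, hanti, habs⟩ := exists_act_antitone κ
  have h1 : g.coeff (act w κ) ≠ 0 := by
    rw [hg.coeff_act]
    exact mul_ne_zero (left_ne_zero_of_mul_eq_one (sgn_mul_self w)) hκ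
  have h2 : StrictAnti (act w κ) := hanti.strictAnti_of_injective fun i j hij => by
    by_contra hne
    exact h1 (hg.coeff_eq_zero hne hij)
  have h3 := isDominant_sub_rho (isHalfOdd_of_coeff_ne_zero hh h1) h2 fun i => by
    obtain ⟨j, hj⟩ := habs i
    rw [hj]
    exact abs_nonneg _
  exact h1 (by simpa using h ⟨_, h3⟩)

lemma finite_support_coeff (g : GroupAlg n) :
    (Function.support fun μ : DominantWeight n => g.coeff (μ.1 + rho n)).Finite := by
  refine Set.Finite.of_finite_image (f := fun μ : DominantWeight n => μ.1 + rho n)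
    (g.coeff.support.finite_toSet.subset ?_)
    fun μ _ ν _ h => Subtype.ext (add_right_cancel h)
  rintro _ ⟨μ, hμ, rfl⟩
  simpa using hμ

/-- Symmetric integral elements are combinations of irreducible characters. -/
lemma eq_finsum_chi {f : GroupAlg n} (hf : ∀ w, actHom w f = f) (hi : ∀ k, phase k f = f) :
    f = ∑ᶠ μ : DominantWeight n, (f * alternant (rho n)).coeff (μ.1 + rho n) • chi μ := by
  classical
  set g := f * alternant (rho n) with hgdef
  have hg : IsAntisymm g := IsAntisymm.invariant_mul hf (isAntisymm_alternant _)
  have hh : ∀ k, phase k g = -g := fun k => by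
    rw [hgdef, map_mul, hi, phase_alternant isHalfOdd_rho, mul_neg]
  have hfin := finite_support_coeff g
  rw [finsum_eq_sum_of_support_subset (s := hfin.toFinset) _ (fun μ hμ => by
    rw [Set.Finite.coe_toFinset, Function.mem_support]
    exact fun h => hμ (by simp [h]))]
  refine mul_right_cancel₀ alternant_rho_ne_zero ?_
  rw [Finset.sum_mul]
  simp only [smul_mul_assoc, chi_mul_alternant]
  rw [← sub_eq_zero]
  refine IsAntisymm.eq_zero (hg.sub (IsAntisymm.sum_smul _ _ _ fun μ => isAntisymm_alternant _))
    (fun k => ?_) fun ν => ?_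
  · have hs : ∀ μ ∈ hfin.toFinset, phase k (g.coeff (μ.1 + rho n) • alternant (μ.1 + rho n)) =
        -(g.coeff (μ.1 + rho n) • alternant (μ.1 + rho n)) := fun μ hμ => by
      rw [map_smul, phase_alternant (isHalfOdd_of_coeff_ne_zero hh ?_), smul_neg]
      simpa using hμ
    rw [map_sub, map_sum, ← hgdef, hh k, Finset.sum_congr rfl hs, Finset.sum_neg_distrib]
    abel
  · rw [← coeffAt_apply, map_sub, map_sum]
    simp only [map_smul, coeffAt_apply, coeff_alternant_dominant, smul_eq_mul, mul_ite, mul_one,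
      mul_zero]
    rw [Finset.sum_ite_eq' , sub_eq_zero]
    split_ifs with h
    · rfl
    · simpa using h

lemma coeff_of_eq_finsum_chi {f : GroupAlg n} {c : DominantWeight n → ℂ}
    (hc : (Function.support c).Finite) (hf : f = ∑ᶠ μ, c μ • chi μ) (ν : DominantWeight n) :
    c ν = (f * alternant (rho n)).coeff (ν.1 + rho n) := by
  classical
  rw [finsum_eq_sum_of_support_subset (s := hc.toFinset) _ (fun μ hμ => by
    rw [Set.Finite.coe_toFinset, Function.mem_support]
    exact fun h => hμ (by simp [h]))] at hf
  rw [hf, Finset.sum_mul]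
  simp only [smul_mul_assoc, chi_mul_alternant]
  rw [← coeffAt_apply, map_sum]
  simp only [map_smul, coeffAt_apply, coeff_alternant_dominant, smul_eq_mul, mul_ite, mul_one,
    mul_zero]
  rw [Finset.sum_ite_eq']
  split_ifs with h
  · rfl
  · simpa using h

/-- The coefficients of the kernel with respect to the irreducible characters. -/
def kernelCoeff (n : ℕ) (μ : DominantWeight n) : QT ℂ := fun d =>
  (MvPowerSeries.coeff d (macdonaldKernel n) * alternant (rho n)).coeff (μ.1 + rho n)

lemma coeff_kernelCoeff (μ : DominantWeight n) (d : Fin 2 →₀ ℕ) :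
    MvPowerSeries.coeff d (kernelCoeff n μ) =
      (MvPowerSeries.coeff d (macdonaldKernel n) * alternant (rho n)).coeff (μ.1 + rho n) := rfl

lemma isKernelExpansion_kernelCoeff (n : ℕ) : IsKernelExpansion n (kernelCoeff n) := fun d =>
  ⟨finite_support_coeff _, eq_finsum_chi (fun w => actHom_coeff_kernel w d)
    fun k => phase_coeff_kernel k d⟩

lemma IsKernelExpansion.eq_kernelCoeff {C : DominantWeight n → QT ℂ} (hC : IsKernelExpansion n C) :
    C = kernelCoeff n := by
  ext μ d
  exact coeff_of_eq_finsum_chi (hC d).1 (hC d).2 μ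

/-! ### The specialization `q → -q`, `t → q^2` -/

/-- The substituted power series `-X` and `X^2`. -/
def specVec (R : Type) [CommRing R] : Fin 2 → MvPowerSeries Unit R :=
  ![-(PowerSeries.X : R⟦X⟧), (PowerSeries.X : R⟦X⟧) ^ 2]

lemma hasSubst_specVec (R : Type) [CommRing R] : MvPowerSeries.HasSubst (specVec R) := by
  refine MvPowerSeries.hasSubst_of_constantCoeff_zero fun s => ?_
  change PowerSeries.constantCoeff _ = 0
  fin_cases s <;> simp [specVec]

/-- The specialization over an arbitrary ring, as a ring homomorphism. -/
def spec (R : Type) [CommRing R] : QT R →+* R⟦X⟧ :=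
  (MvPowerSeries.substAlgHom (R := R) (hasSubst_specVec R)).toRingHom

lemma spec_apply (R : Type) [CommRing R] (f : QT R) :
    spec R f = MvPowerSeries.subst (specVec R) f :=
  MvPowerSeries.substAlgHom_apply (hasSubst_specVec R) f

lemma spec_X_zero (R : Type) [CommRing R] : spec R (MvPowerSeries.X 0) = -PowerSeries.X :=
  (spec_apply R _).trans (MvPowerSeries.subst_X (hasSubst_specVec R) 0)

lemma spec_X_one (R : Type) [CommRing R] : spec R (MvPowerSeries.X 1) = PowerSeries.X ^ 2 :=
  (spec_apply R _).trans (MvPowerSeries.subst_X (hasSubst_specVec R) 1)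

lemma spec_C (R : Type) [CommRing R] (r : R) : spec R (MvPowerSeries.C r) = PowerSeries.C r :=
  (spec_apply R _).trans (MvPowerSeries.subst_C r)

lemma coeff_spec (R : Type) [CommRing R] (f : QT R) (N : ℕ) :
    PowerSeries.coeff N (spec R f) =
      ∑ᶠ d : Fin 2 →₀ ℕ, if d 0 + 2 * d 1 = N then (-1) ^ d 0 * MvPowerSeries.coeff d f else 0 := by
  have h := MvPowerSeries.coeff_subst (hasSubst_specVec R) f (Finsupp.single () N)
  rw [spec_apply]
  refine h.trans (finsum_congr fun d => ?_)
  have h1 : (d.prod fun s e => specVec R s ^ e) =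
      PowerSeries.C ((-1) ^ d 0) * (PowerSeries.X : R⟦X⟧) ^ (d 0 + 2 * d 1) := by
    rw [Finsupp.prod_fintype _ _ (by simp), Fin.prod_univ_two]
    change (-(PowerSeries.X : R⟦X⟧)) ^ d 0 * (PowerSeries.X ^ 2) ^ d 1 = _
    rw [neg_pow, pow_add, pow_mul]
    simp [mul_assoc]
  have h2 : MvPowerSeries.coeff (Finsupp.single () N) (d.prod fun s e => specVec R s ^ e) =
      if d 0 + 2 * d 1 = N then (-1) ^ d 0 else 0 := by
    rw [h1]
    change PowerSeries.coeff N (PowerSeries.C ((-1) ^ d 0) * (PowerSeries.X : R⟦X⟧) ^ _) = _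
    rw [PowerSeries.coeff_C_mul, PowerSeries.coeff_X_pow]
    simp [eq_comm]
  rw [h2, smul_eq_mul]
  split_ifs
  · ring
  · simp

lemma finite_weight_fiber (N : ℕ) : {d : Fin 2 →₀ ℕ | d 0 + 2 * d 1 = N}.Finite := by
  refine Set.Finite.subset (Set.finite_Iic (Finsupp.single 0 N + Finsupp.single 1 N))
    fun d hd => ?_
  rw [Set.mem_ofPred_eq] at hd
  intro i
  fin_cases i <;> simp <;> omega

/-- Coefficientwise application of a linear functional commutes with the specialization. -/
lemma coeff_spec_functional (L : GroupAlg n →ₗ[ℂ] ℂ) {F : QT (GroupAlg n)} {G : QT ℂ}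
    (h : ∀ d, MvPowerSeries.coeff d G = L (MvPowerSeries.coeff d F)) (N : ℕ) :
    PowerSeries.coeff N (spec ℂ G) = L (PowerSeries.coeff N (spec (GroupAlg n) F)) := by
  rw [coeff_spec, coeff_spec]
  have hfin : (Function.support fun d : Fin 2 →₀ ℕ => if d 0 + 2 * d 1 = N then
      (-1) ^ d 0 * MvPowerSeries.coeff d F else 0).Finite :=
    (finite_weight_fiber N).subset fun d hd => by
      by_contra hne
      exact hd (if_neg hne)
  have h1 := AddMonoidHom.map_finsum L.toAddMonoidHom hfin
  refine Eq.trans (finsum_congr fun d => ?_) h1.symm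
  rw [h]
  split_ifs
  · change _ = L _
    rcases Nat.even_or_odd (d 0) with he | ho
    · simp [he.neg_one_pow]
    · simp [ho.neg_one_pow]
  · exact (map_zero L).symm

lemma specialize_eq_spec (f : QT ℂ) : specialize f = spec ℂ f := (spec_apply ℂ f).symm

/-- Telescoping: t q^i becomes (-q)^{i+2}, so each denominator equals the next numerator. The
remaining factor is 1 modulo X^{M+1}. -/
lemma prod_spec_factor (μ : Wt n) (M : ℕ) :
    (∏ i ∈ Finset.range M, spec (GroupAlg n) (factor i μ)) *
      (1 - (-PowerSeries.X) ^ (M + 1) * PowerSeries.C (expo μ)) =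
    1 + PowerSeries.X * PowerSeries.C (expo μ) := by
  induction M with
  | zero => simp
  | succ M ih =>
    have h := congrArg (spec (GroupAlg n)) (factor_mul M μ)
    simp only [map_mul, map_sub, map_one, map_pow, spec_X_zero, spec_X_one, spec_C] at h
    rw [Finset.prod_range_succ, mul_assoc, ← ih, ← h]
    ring

/-- The graded character of the exterior algebra, as a polynomial in the grading variable. -/
def adjointPoly (n : ℕ) : (GroupAlg n)[X] :=
  (1 + Polynomial.X * Polynomial.C (expo 0)) ^ n *
    ∏ α ∈ roots n, (1 + Polynomial.X * Polynomial.C (expo α))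

lemma eval_adjointPoly (q : ℂ) :
    (adjointPoly n).eval (algebraMap ℂ (GroupAlg n) q) = adjointProd n q := by
  simp only [adjointPoly, adjointProd_eq, Polynomial.eval_prod, Algebra.smul_def,
    Polynomial.eval_mul, Polynomial.eval_pow, Polynomial.eval_add, Polynomial.eval_one,
    Polynomial.eval_X, Polynomial.eval_C]

lemma X_pow_dvd_prod_spec_layer_sub (n M : ℕ) :
    (PowerSeries.X : (GroupAlg n)⟦X⟧) ^ (M + 1) ∣
      (∏ i ∈ Finset.range M, spec (GroupAlg n) (layer n i)) - (adjointPoly n : (GroupAlg n)⟦X⟧) := by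
  set I := Ideal.span {(PowerSeries.X : (GroupAlg n)⟦X⟧) ^ (M + 1)} with hI
  have key : ∀ μ : Wt n, Ideal.Quotient.mk I (∏ i ∈ Finset.range M, spec (GroupAlg n) (factor i μ)) =
      Ideal.Quotient.mk I (1 + PowerSeries.X * PowerSeries.C (expo μ)) := fun μ => by
    rw [Ideal.Quotient.eq, hI, Ideal.mem_span_singleton, ← prod_spec_factor μ M, neg_pow]
    exact ⟨(∏ i ∈ Finset.range M, spec (GroupAlg n) (factor i μ)) * (-1) ^ (M + 1) *
      PowerSeries.C (expo μ), by ring⟩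
  have hpoly : (adjointPoly n : (GroupAlg n)⟦X⟧) = (1 + PowerSeries.X * PowerSeries.C (expo 0)) ^ n *
      ∏ α ∈ roots n, (1 + PowerSeries.X * PowerSeries.C (expo α)) := by
    change Polynomial.coeToPowerSeries.ringHom (adjointPoly n) = _
    rw [adjointPoly, map_mul, map_pow, map_prod]
    simp only [map_add, map_one, map_mul, Polynomial.coeToPowerSeries.ringHom_apply,
      Polynomial.coe_X, Polynomial.coe_C]
  rw [← Ideal.mem_span_singleton, ← hI, ← Ideal.Quotient.eq, hpoly]
  simp only [layer, map_mul, map_pow, map_prod, Finset.prod_mul_distrib, Finset.prod_pow]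
  rw [Finset.prod_comm]
  simp only [map_prod] at key
  simp only [key, map_add, map_mul, map_one]

lemma coeff_spec_kernel (n N : ℕ) :
    PowerSeries.coeff N (spec (GroupAlg n) (macdonaldKernel n)) = (adjointPoly n).coeff N := by
  -- Monomials q^a t^b specialising to degree N satisfy a + 2b = N, so a ≤ N and the layers with i ≤
  -- N suffice.
  have h1 : PowerSeries.coeff N (spec (GroupAlg n) (macdonaldKernel n)) =
      PowerSeries.coeff N (spec (GroupAlg n) (∏ i ∈ Finset.range (N + 1), layer n i)) := by
    rw [coeff_spec, coeff_spec]
    refine finsum_congr fun d => ?_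
    split_ifs with h
    · rw [coeff_prod_layer n d (N + 1) (by omega)]
    · rfl
  rw [h1, map_prod, ← Polynomial.coeff_coe, ← sub_eq_zero, ← map_sub]
  exact PowerSeries.X_pow_dvd_iff.1 (X_pow_dvd_prod_spec_layer_sub n (N + 1)) N (by omega)

/-- The coefficient functional `f ↦ [e^{μ+ρ}] (f ∑ (-1)^{l(w)} e^{wρ})`. -/
def multiplicity (μ : DominantWeight n) : GroupAlg n →ₗ[ℂ] ℂ :=
  coeffAt (μ.1 + rho n) ∘ₗ LinearMap.mulRight ℂ (alternant (rho n))

lemma multiplicity_apply (μ : DominantWeight n) (f : GroupAlg n) :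
    multiplicity μ f = (f * alternant (rho n)).coeff (μ.1 + rho n) := rfl

/-- The specialized coefficient is determined by its values at complex numbers. -/
lemma specialize_kernelCoeff_eq {μ : DominantWeight n} {P : ℂ[X]}
    (hP : ∀ q, multiplicity μ (adjointProd n q) = P.eval q) :
    specialize (kernelCoeff n μ) = (P : ℂ⟦X⟧) := by
  -- The functional is applied to the coefficients of `adjointPoly`; the result agrees with P at
  -- every complex number, hence as a polynomial.
  set Q : ℂ[X] := ∑ N ∈ Finset.range ((adjointPoly n).natDegree + 1),
    Polynomial.C (multiplicity μ ((adjointPoly n).coeff N)) * Polynomial.X ^ N with hQ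
  have hPQ : P = Q := by
    refine Polynomial.funext fun q => ?_
    rw [← hP, ← eval_adjointPoly, Polynomial.eval_eq_sum_range, map_sum, hQ,
      Polynomial.eval_finsetSum]
    refine Finset.sum_congr rfl fun N _ => ?_
    rw [← map_pow, mul_comm, ← Algebra.smul_def, map_smul, smul_eq_mul]
    rw [Polynomial.eval_mul, Polynomial.eval_C, Polynomial.eval_pow, Polynomial.eval_X, mul_comm]
  ext N
  rw [specialize_eq_spec, coeff_spec_functional (multiplicity μ) (G := kernelCoeff n μ)
    (F := macdonaldKernel n) (coeff_kernelCoeff μ), coeff_spec_kernel, Polynomial.coeff_coe, hPQ, hQ, Polynomial.finsetSum_coeff]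
  simp only [Polynomial.coeff_C_mul, Polynomial.coeff_X_pow, mul_ite, mul_one, mul_zero]
  rw [Finset.sum_ite_eq]
  split_ifs with h
  · rfl
  · rw [Polynomial.coeff_eq_zero_of_natDegree_lt (by simpa using h), map_zero]

lemma specialize_kernelCoeff_omegaWeight {m h : ℕ} (hm : m ≤ n)
    (hh : h = if Even m then n - m / 2 else (m - 1) / 2) (hn : h < n) :
    specialize (kernelCoeff n (omegaWeight n m)) =
      (((qBinomial n h).comp (Polynomial.X ^ 4) *
        (∏ j ∈ Finset.Icc 1 h, (1 + Polynomial.X ^ (4 * j - 1))) *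
        (∏ r ∈ Finset.Icc 1 (n - h - 1), (1 + Polynomial.X ^ (4 * r - 1))) *
        (Polynomial.X ^ (2 * (n - h)) + Polynomial.X ^ (2 * (n - h) - 1)) :
          Polynomial ℂ) : PowerSeries ℂ) := by
  refine specialize_kernelCoeff_eq fun q => ?_
  obtain ⟨k, rfl⟩ : ∃ k, n = k + 1 + h := ⟨n - h - 1, by omega⟩
  rw [multiplicity_apply, coeff_adjointProd q (adjointProd_invariant q) hm, ← two_mul]
  -- Of m and 2n+1-m the odd one contributes zero; the definition of h makes the even one equal to
  -- 2(n-h) in both cases.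
  have h1 : rowSum q (2 * (k + 1 + h)) m + rowSum q (2 * (k + 1 + h)) (2 * (k + 1 + h) + 1 - m) =
      rowSum q (2 * (k + 1 + h)) (2 * (k + 1)) := by
    split_ifs at hh with he
    · rw [rowSum_odd q _ (2 * (k + 1 + h) + 1 - m) (by
        rw [Nat.even_iff] at he; rw [Nat.odd_iff]; omega), add_zero]
      congr 1
      rw [Nat.even_iff] at he
      omega
    · rw [Nat.not_even_iff_odd] at he
      rw [rowSum_odd q _ m he, zero_add]
      congr 1
      rw [Nat.odd_iff] at he
      omega
  rw [h1, rowSum_two_mul, show k + 1 + h - h - 1 = k by omega,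
    show 2 * (k + 1 + h - h) = 2 * k + 2 by omega, show 2 * k + 2 - 1 = 2 * k + 1 by omega]
  simp [quadProd, Polynomial.eval_prod, Polynomial.eval_comp]

end TypeB

end

theorem mainTheorem4 (n : ℕ) (hn : 1 ≤ n) :
    ∃ C : TypeB.DominantWeight n → TypeB.QT ℂ,
      TypeB.IsKernelExpansion n C ∧
      (∀ C', TypeB.IsKernelExpansion n C' → C' = C) ∧
      ∀ m h : ℕ, m ≤ n → h = (if Even m then n - m / 2 else (m - 1) / 2) → h < n →
        TypeB.specialize (C (TypeB.omegaWeight n m)) =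
          (((TypeB.qBinomial n h).comp (Polynomial.X ^ 4) *
            (∏ j ∈ Finset.Icc 1 h, (1 + Polynomial.X ^ (4 * j - 1))) *
            (∏ r ∈ Finset.Icc 1 (n - h - 1), (1 + Polynomial.X ^ (4 * r - 1))) *
            (Polynomial.X ^ (2 * (n - h)) + Polynomial.X ^ (2 * (n - h) - 1)) :
              Polynomial ℂ) : PowerSeries ℂ) :=
  ⟨TypeB.kernelCoeff n, TypeB.isKernelExpansion_kernelCoeff n, fun _ hC => hC.eq_kernelCoeff,
    fun _ _ hm hh hlt => TypeB.specialize_kernelCoeff_omegaWeight hm hh hlt⟩
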